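/- Let $\mathscr{H}$ be a complex Hilbert space, let $\mathfrak{A}=\mathbb{K}(\mathscr{H})$ be the $C^*$-algebra of compact operators on $\mathscr{H}$, let $\mathscr{X}$ be a (right) Hilbert $\mathfrak{A}$-module with inner product $\langle\cdot,\cdot\rangle$ (linear in the second variable), and let $x=(x_1,\dots,x_n)\in\mathscr{X}^n$. Write $|a|^2=a^*a$ for $a\in\mathfrak{A}$. Notation. For a Hilbert $C^*$-module $\mathscr{Y}$ (in particular, for a Hilbert space, regarded as a Hilbert $\mathbb{C}$-module) and $y\in\mathscr{Y}^n$, let $$\|y\|_n^{\mathscr{Y}}=\sup\|P_1y_1+\dots+P_ny_n\|,$$ where the supremum is over all families $(P_1,\dots,P_n)$ of mutually orthogonal projections (possibly zero) in the algebra $\mathcal{L}(\mathscr{Y})$ of adjointable maps with $\sum_iP_i=I_{\mathscr{Y}}$. Let $\mathcal{P}(\mathfrak{A})$ be the set of pure states of $\mathfrak{A}$; for $\tau\in\mathcal{P}(\mathfrak{A})$ let $\mathcal{N}_\tau=\{z\in\mathscr{X}:\tau(\langle z,z\rangle)=0\}$, and let $\mathscr{H}_\tau$ be the Hilbert completion of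 $\mathscr{X}/\mathcal{N}_\tau$ for the inner product $\langle z+\mathcal{N}_\tau,w+\mathcal{N}_\tau\rangle=\tau(\langle z,w\rangle)$. Put $$\|x\|_n^{\mathcal{P}(\mathfrak{A})}=\sup_{\tau\in\mathcal{P}(\mathfrak{A})}\|(x_1+\mathcal{N}_\tau,\dots,x_n+\mathcal{N}_\tau)\|_n^{\mathscr{H}_\tau}.$$ For $y\in\mathscr{X}^n$ put $$\mu_n^*(y)=\sup_{z\in\mathscr{X},\,\|z\|\le1}\Big\|\Big(\sum_{i=1}^n|\langle y_i,z\rangle|^2\Big)^{1/2}\Big\|,\qquad \|x\|_n^*=\sup\Big\{\Big\|\sum_{i=1}^n|\langle y_i,x_i\rangle|^2\Big\|^{1/2}:y\in\mathscr{X}^n,\ \mu_n^*(y)\le1\Big\}.$$ The suprema are taken in $[0,\infty)$, with $\sup\emptyset=0$. A minimal projection of $\mathfrak{A}$ is a nonzero projection $e$ with $e\mathfrak{A}e=\mathbb{C}e$. An orthonormal basis of $\mathscr{X}$ is a set of mutually orthogonal elements $u$, each with $\langle u,u\rangle$ a minimal projection, that generates a dense submodule; o-dim$(\mathscr{X})$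 is the cardinality of any orthonormal basis of $\mathscr{X}$, and o-dim$(\mathscr{H})$ is the Hilbert dimension of $\mathscr{H}$. Theorem. (1) $\|x\|_n^{\mathscr{X}}=\|x\|_n^{\mathcal{P}(\mathfrak{A})}$. (2) If $\mathscr{H}$ is separable and o-dim$(\mathscr{X})\ge n\cdot$o-dim$(\mathscr{H})$, then $\|x\|_n^{\mathscr{X}}=\|x\|_n^*$. -/

import Mathlib

open scoped ComplexOrder

universe u v

noncomputable section

namespace HilbertMulti

/-! ### The C⋆-algebra of compact operators -/

section Compact

variable (H : Type*) [NormedAddCommGroup H] [InnerProductSpace ℂ H] [CompleteSpace H]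

/-- Schauder: the adjoint of a compact operator on a Hilbert space is compact. -/
theorem isCompactOperator_adjoint {T : H →L[ℂ] H} (hT : IsCompactOperator T) :
    IsCompactOperator (ContinuousLinearMap.adjoint T) := by
  set S := ContinuousLinearMap.adjoint T with hS
  have hTS : IsCompactOperator (T ∘L S) := hT.comp_clm S
  rw [show (⇑S : H → H) = ⇑(S : H →ₗ[ℂ] H) from rfl,
    isCompactOperator_iff_isCompact_closure_image_closedBall (S : H →ₗ[ℂ] H) zero_lt_one]
  have h1 : TotallyBounded ((T ∘L S) '' Metric.closedBall (0 : H) 1) :=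
    ((IsCompactOperator.isCompact_closure_image_closedBall (f := ((T ∘L S : H →L[ℂ] H) : H →ₗ[ℂ] H))
      hTS 1).totallyBounded).subset subset_closure
  refine TotallyBounded.isCompact_of_isClosed (TotallyBounded.closure ?_) isClosed_closure
  rw [Metric.totallyBounded_iff]
  intro ε hε
  obtain ⟨t, htS, htf, htc⟩ :=
    Metric.finite_approx_of_totallyBounded h1 (ε ^ 2 / 2) (by positivity)
  obtain ⟨t', ht'S, ht'f, htc⟩ := Set.exists_subset_image_finite_and
    (p := fun t => (T ∘L S) '' Metric.closedBall (0 : H) 1 ⊆ ⋃ y ∈ t, Metric.ball y (ε ^ 2 / 2))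
    |>.1 ⟨t, htS, htf, htc⟩
  refine ⟨S '' t', ht'f.image _, ?_⟩
  rintro _ ⟨x, hx, rfl⟩
  have hx' := htc (Set.mem_image_of_mem _ hx)
  simp only [Set.mem_iUnion] at hx'
  obtain ⟨y, hy, hxy⟩ := hx'
  obtain ⟨z, hz, rfl⟩ := hy
  simp only [Set.mem_iUnion]
  refine ⟨S z, Set.mem_image_of_mem _ hz, ?_⟩
  rw [Metric.mem_ball, dist_eq_norm] at hxy ⊢
  have e1 : ‖S x - S z‖ ^ 2 ≤ ‖T (S (x - z))‖ * ‖x - z‖ := by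
    rw [← map_sub, ← inner_self_eq_norm_sq (𝕜 := ℂ)]
    have : inner ℂ (S (x - z)) (S (x - z)) = inner ℂ (T (S (x - z))) (x - z) := by
      rw [hS, ContinuousLinearMap.adjoint_inner_right]
    rw [this]
    exact (RCLike.re_le_norm _).trans (norm_inner_le_norm _ _)
  have e2 : ‖x - z‖ ≤ 2 := by
    have h3 := ht'S hz
    rw [mem_closedBall_zero_iff] at h3 hx
    exact (norm_sub_le _ _).trans (by linarith)
  have e3 : ‖T (S (x - z))‖ < ε ^ 2 / 2 := by simpa using hxy
  have e4 : ‖S x - S z‖ ^ 2 < ε ^ 2 := by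
    nlinarith [norm_nonneg (T (S (x - z))), norm_nonneg (x - z)]
  exact lt_of_pow_lt_pow_left₀ 2 hε.le e4

/-- The compact operators on a Hilbert space, as a ⋆-subalgebra of the bounded operators. -/
def compactSubalgebra : NonUnitalStarSubalgebra ℂ (H →L[ℂ] H) where
  carrier := {T | IsCompactOperator T}
  add_mem' hS hT := IsCompactOperator.add hS hT
  zero_mem' := isCompactOperator_zero
  mul_mem' {S} {_} _ hT := IsCompactOperator.clm_comp hT S
  smul_mem' c _ hT := IsCompactOperator.smul hT c
  star_mem' hT := isCompactOperator_adjoint H hT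

/-- The algebra `𝕂(H)`. Its norm is the operator norm and its order is the Loewner order, both
inherited from the bounded operators. -/
abbrev CompactOp : Type _ := ↥(compactSubalgebra H)

/-- This makes `CompactOp H` a `NonUnitalCStarAlgebra`. -/
instance isClosed_compactSubalgebra :
    IsClosed (compactSubalgebra H : Set (H →L[ℂ] H)) :=
  isClosed_setOfPred_isCompactOperator

end Compact

/-! ### The Hilbert C⋆-multi-norm

The definitions in this section do not depend on the order of multiplication in the algebra. -/

section HilbertMultiNorm

variable (A : Type*) {X : Type*} [NonUnitalCStarAlgebra A] [PartialOrder A]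
  [NormedAddCommGroup X] [NormedSpace ℂ X] [SMul A X] [CStarModule A X]

/-- `P : X → X` is a projection in the C⋆-algebra of adjointable maps: it is its own adjoint
and idempotent. (Adjointable maps are automatically linear and bounded.) -/
structure IsProjection (P : X → X) : Prop where
  self_adjoint : ∀ x y : X, inner A (P x) y = inner A x (P y)
  idempotent : ∀ x : X, P (P x) = P x

/-- A family of mutually orthogonal projections (some may vanish) summing to the identity. -/
structure IsProjectionDecomposition {n : ℕ} (P : Fin n → X → X) : Prop where
  isProjection : ∀ i, IsProjection A (P i)
  orthogonal : ∀ i j, i ≠ j → ∀ x : X, P i (P j x) = 0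
  sum_eq : ∀ x : X, ∑ i, P i x = x

/-- The Hilbert C⋆-multi-norm `‖(x₁, …, xₙ)‖ₙ^X`. -/
def hilbertMultiNorm {n : ℕ} (x : Fin n → X) : ℝ :=
  sSup {r : ℝ | ∃ P : Fin n → X → X, IsProjectionDecomposition A P ∧ r = ‖∑ i, P i (x i)‖}

end HilbertMultiNorm

/-! ### Right Hilbert C⋆-modules

Mathlib's `CStarModule B X` satisfies `⟪x, b • y⟫ = b * ⟪x, y⟫` with an inner product that is linear
in the second variable. Hence a right Hilbert `A`-module, with `⟪x, y a⟫ = ⟪x, y⟫ a`, is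
`CStarModule Aᵐᵒᵖ X`, where the right action is `x a = MulOpposite.op a • x` and the `A`-valued
inner product is `rinner A x y` below. -/

section Right

variable (A : Type*) {X : Type*} [NonUnitalCStarAlgebra A] [PartialOrder A]
  [NormedAddCommGroup X] [NormedSpace ℂ X] [SMul Aᵐᵒᵖ X] [CStarModule Aᵐᵒᵖ X]

/-- The `A`-valued inner product of a right Hilbert `A`-module. -/
def rinner (x y : X) : A := MulOpposite.unop (inner Aᵐᵒᵖ x y)

theorem rinner_op_smul_right (x y : X) (a : A) :
    rinner A x (MulOpposite.op a • y) = rinner A x y * a := by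
  simp [rinner]

theorem star_rinner (x y : X) : star (rinner A x y) = rinner A y x := by
  simp [rinner, ← MulOpposite.unop_star]

theorem rinner_self_nonneg (x : X) : 0 ≤ rinner A x x :=
  MulOpposite.unop_nonneg.2 CStarModule.inner_self_nonneg

theorem rinner_add_right (x y z : X) : rinner A x (y + z) = rinner A x y + rinner A x z := by
  simp [rinner]

theorem rinner_add_left (x y z : X) : rinner A (x + y) z = rinner A x z + rinner A y z := by
  simp [rinner]

theorem rinner_smul_right (c : ℂ) (x y : X) : rinner A x (c • y) = c • rinner A x y := by
  simp [rinner]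

theorem rinner_smul_left (c : ℂ) (x y : X) : rinner A (c • x) y = star c • rinner A x y := by
  simp [rinner]

/-- `μₙ*(x₁, …, xₙ) = sup_{‖y‖ ≤ 1} ‖(∑ |⟨xᵢ, y⟩|²)^{1/2}‖`, where `|a|² = a⋆ a`. -/
def muStar {n : ℕ} (x : Fin n → X) : ℝ :=
  sSup {r : ℝ | ∃ y : X, ‖y‖ ≤ 1 ∧
    r = √‖∑ i, star (rinner A (x i) y) * rinner A (x i) y‖}

/-- `‖x‖ₙ* = sup {‖∑ |⟨yᵢ, xᵢ⟩|²‖^{1/2} : μₙ*(y₁, …, yₙ) ≤ 1}`. -/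
def starMultiNorm {n : ℕ} (x : Fin n → X) : ℝ :=
  sSup {r : ℝ | ∃ y : Fin n → X, muStar A y ≤ 1 ∧
    r = √‖∑ i, star (rinner A (y i) (x i)) * rinner A (y i) (x i)‖}

end Right

/-! ### Pure states and localizations -/

section PureStates

/-- A bounded linear functional is positive if it is nonnegative on positive elements. -/
def IsPositiveFunctional {A : Type*} [NonUnitalCStarAlgebra A] [PartialOrder A]
    (τ : A →L[ℂ] ℂ) : Prop :=
  ∀ a : A, 0 ≤ a → 0 ≤ τ a

/-- Pure states: positive functionals of norm one such that every positive functional `ρ ≤ τ` is of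
the form `t τ` with `0 ≤ t ≤ 1`. -/
structure PureState (A : Type*) [NonUnitalCStarAlgebra A] [PartialOrder A] where
  toFunctional : A →L[ℂ] ℂ
  positive : IsPositiveFunctional toFunctional
  norm_eq_one : ‖toFunctional‖ = 1
  pure : ∀ ρ : A →L[ℂ] ℂ, IsPositiveFunctional ρ → IsPositiveFunctional (toFunctional - ρ) →
    ∃ t : ℝ, 0 ≤ t ∧ t ≤ 1 ∧ ρ = (t : ℂ) • toFunctional

variable {A : Type*} [NonUnitalCStarAlgebra A] [PartialOrder A]

/-- A copy of `X`, to carry the semi-inner product `τ(⟨x, y⟩)`. -/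
def PreLocalization (_τ : PureState A) (X : Type*) : Type _ := X

variable (τ : PureState A) (X : Type*) [NormedAddCommGroup X] [NormedSpace ℂ X]

instance : AddCommGroup (PreLocalization τ X) := inferInstanceAs (AddCommGroup X)

instance : Module ℂ (PreLocalization τ X) := inferInstanceAs (Module ℂ X)

variable [SMul Aᵐᵒᵖ X] [CStarModule Aᵐᵒᵖ X]

theorem conj_functional_rinner (x y : X) :
    star (τ.toFunctional (rinner A y x)) = τ.toFunctional (rinner A x y) := by
  have key : ∀ z : X, (τ.toFunctional (rinner A z z)).im = 0 := fun z =>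
    ((Complex.nonneg_iff.1 (τ.positive _ (rinner_self_nonneg A z))).2).symm
  have hx := key x
  have hy := key y
  have h1 := key (x + y)
  have h2 := key (x + Complex.I • y)
  simp only [rinner_add_right, rinner_add_left, rinner_smul_right, rinner_smul_left, map_add,
    map_smul, smul_eq_mul, Complex.add_im, Complex.star_def, Complex.conj_I, Complex.mul_im,
    Complex.add_re, Complex.mul_re, Complex.neg_re, Complex.neg_im, Complex.I_re, Complex.I_im, hx, hy] at h1 h2
  apply Complex.ext
  · simp only [Complex.star_def, Complex.conj_re]
    linarith
  · simp only [Complex.star_def, Complex.conj_im]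
    linarith

/-- The semi-inner product `⟨x, y⟩_τ = τ(⟨x, y⟩)`. -/
abbrev preLocalizationCore : PreInnerProductSpace.Core ℂ (PreLocalization τ X) where
  inner x y := τ.toFunctional (rinner (X := X) A x y)
  conj_inner_symm x y := conj_functional_rinner τ X x y
  re_inner_nonneg x :=
    (Complex.nonneg_iff.1 (τ.positive _ (rinner_self_nonneg (X := X) A x))).1
  add_left x y z :=
    (congrArg τ.toFunctional (rinner_add_left (X := X) A x y z)).trans (map_add _ _ _)
  smul_left x y c :=
    (congrArg τ.toFunctional (rinner_smul_left (X := X) A c x y)).trans (map_smul _ _ _)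

instance : SeminormedAddCommGroup (PreLocalization τ X) :=
  InnerProductSpace.Core.toSeminormedAddCommGroup (c := preLocalizationCore τ X)

instance : InnerProductSpace ℂ (PreLocalization τ X) :=
  InnerProductSpace.ofCore (preLocalizationCore τ X)

/-- The Hilbert space `H_τ`. The Hausdorff completion of `X` for the seminorm `τ(⟨x, x⟩)^{1/2}` is
the Hilbert completion of `X / N_τ`, where `N_τ = {x | τ(⟨x, x⟩) = 0}`. -/
abbrev Localization : Type _ := UniformSpace.Completion (PreLocalization τ X)

variable {X} in
/-- The class `x + N_τ` in `H_τ`. -/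
def toLocalization (x : X) : Localization τ X :=
  UniformSpace.Completion.coe' (show PreLocalization τ X from x)

theorem inner_toLocalization (x y : X) :
    inner ℂ (toLocalization τ x) (toLocalization τ y) = τ.toFunctional (rinner A x y) :=
  UniformSpace.Completion.inner_coe (𝕜 := ℂ) (E := PreLocalization τ X) x y

theorem toLocalization_eq_zero_iff (x : X) :
    toLocalization τ x = 0 ↔ τ.toFunctional (rinner A x x) = 0 := by
  rw [← inner_toLocalization, inner_self_eq_zero]

variable (A) {X} in
/-- `‖x‖ₙ^{P(A)}`: the supremum over all pure states `τ` of the Hilbert multi-norm of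
`(x₁ + N_τ, …, xₙ + N_τ)` in the Hilbert space `H_τ`. -/
def pureStateMultiNorm {n : ℕ} (x : Fin n → X) : ℝ :=
  sSup {r : ℝ | ∃ τ : PureState A,
    r = hilbertMultiNorm ℂ (fun i => toLocalization τ (x i))}

end PureStates

/-! ### Orthogonal dimension -/

section Dimension

/-- A minimal projection of `A`: a nonzero projection `e` with `e A e = ℂ e`. -/
structure IsMinimalProjection {A : Type*} [NonUnitalCStarAlgebra A] (e : A) : Prop where
  isStarProjection : IsStarProjection e
  ne_zero : e ≠ 0
  corner : ∀ a : A, ∃ c : ℂ, e * a * e = c • e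

variable (A X : Type*) [NonUnitalCStarAlgebra A] [PartialOrder A]
  [NormedAddCommGroup X] [NormedSpace ℂ X] [SMul Aᵐᵒᵖ X] [CStarModule Aᵐᵒᵖ X]

/-- An orthonormal basis of a right Hilbert `A`-module: mutually orthogonal vectors `u` for which
`⟨u, u⟩` is a minimal projection, generating a dense submodule. -/
structure IsOrthonormalBasis (S : Set X) : Prop where
  basic : ∀ u ∈ S, IsMinimalProjection (rinner A u u)
  orthogonal : ∀ u ∈ S, ∀ v ∈ S, u ≠ v → rinner A u v = 0
  dense : Dense (Submodule.span ℂ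
    (S ∪ {x : X | ∃ u ∈ S, ∃ a : A, x = MulOpposite.op a • u}) : Set X)

/-- The orthogonal dimension of a right Hilbert `A`-module: the cardinality of its orthonormal
bases. -/
def orthDim : Cardinal :=
  sInf {c : Cardinal | ∃ S : Set X, IsOrthonormalBasis A X S ∧ c = Cardinal.mk S}

/-- The Hilbert dimension of a Hilbert space: the cardinality of its orthonormal bases. -/
def hilbertDim (H : Type*) [NormedAddCommGroup H] [InnerProductSpace ℂ H] : Cardinal :=
  sInf {c : Cardinal | ∃ S : Set H, Orthonormal ℂ (Subtype.val : S → H) ∧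
    Dense (Submodule.span ℂ S : Set H) ∧ c = Cardinal.mk S}

end Dimension

end HilbertMulti

end

/-!
Fix a unit vector `ζ` of `H`, let `K` be the localization of `X` at the vector state of `ζ` and `L`
the canonical map from `X` to `K`. Sending `x` to the operator `T x : η ↦ L (x |η⟩⟨ζ|)` realizes `X`
isometrically as a space of operators from `H` to `K` which contains every rank-one operator and
satisfies `⟨x, y⟩ = (T x)† T y`. Hence every adjointable projection of `X` is composition with a
projection of `K`, and conversely. Since every pure state of `𝕂(H)` is a vector state and
`‖x‖ = sup ‖T x ζ‖`, this gives the first equality.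

For the second one, the families `y` with `μ*(y) ≤ 1` correspond, after evaluation at unit vectors,
to the Bessel families with bound `1` in `K`, that is, to contractions from `ℂⁿ` to `K`. The
hypothesis on the orthogonal dimension says that `K` has dimension at least `n`, so each such
contraction is the mean of two isometries. Bessel families are thereby reduced to orthonormal ones,
which are subordinate to projection decompositions of `K`.
-/

noncomputable section

namespace HilbertMulti

/-! ### Hilbert C⋆-modules -/

section CStarModule

variable {A X : Type*} [NonUnitalCStarAlgebra A] [PartialOrder A]
  [NormedAddCommGroup X] [NormedSpace ℂ X] [SMul A X] [CStarModule A X]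

theorem eq_of_forall_inner_eq {x y : X} (h : ∀ z : X, inner A z x = inner A z y) : x = y := by
  rw [← sub_eq_zero, ← CStarModule.inner_self (A := A), CStarModule.inner_sub_right, h, sub_self]

theorem mul_smul_algebra (a b : A) (x : X) : (a * b) • x = a • b • x :=
  eq_of_forall_inner_eq (A := A) fun z => by
    simp only [CStarModule.inner_op_smul_right, mul_assoc]

variable (A X) in
/-- The action of the coefficient algebra of a Hilbert C⋆-module as a `ℂ`-bilinear map; Mathlib's
`CStarModule` records it as a bare `SMul`. -/
def algebraSMul : A →ₗ[ℂ] X →ₗ[ℂ] X :=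
  LinearMap.mk₂ ℂ (fun a x => a • x)
    (fun a b x => eq_of_forall_inner_eq (A := A) fun z => by
      simp only [CStarModule.inner_op_smul_right, CStarModule.inner_add_right, add_mul])
    (fun c a x => eq_of_forall_inner_eq (A := A) fun z => by
      simp only [CStarModule.inner_op_smul_right, CStarModule.inner_smul_right_complex,
        smul_mul_assoc])
    (fun a x y => eq_of_forall_inner_eq (A := A) fun z => by
      simp only [CStarModule.inner_op_smul_right, CStarModule.inner_add_right, mul_add])
    fun c a x => eq_of_forall_inner_eq (A := A) fun z => by
      simp only [CStarModule.inner_op_smul_right, CStarModule.inner_smul_right_complex,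
        mul_smul_comm]

@[simp]
theorem algebraSMul_apply (a : A) (x : X) : algebraSMul A X a x = a • x := rfl

namespace IsProjection

variable {P : X → X}

theorem map_add (hP : IsProjection A P) (x y : X) : P (x + y) = P x + P y :=
  eq_of_forall_inner_eq (A := A) fun z => by
    simp only [← hP.self_adjoint, CStarModule.inner_add_right]

theorem map_smul (hP : IsProjection A P) (c : ℂ) (x : X) : P (c • x) = c • P x :=
  eq_of_forall_inner_eq (A := A) fun z => by
    simp only [← hP.self_adjoint, CStarModule.inner_smul_right_complex]

theorem map_smul_algebra (hP : IsProjection A P) (a : A) (x : X) : P (a • x) = a • P x :=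
  eq_of_forall_inner_eq (A := A) fun z => by
    simp only [← hP.self_adjoint, CStarModule.inner_op_smul_right]

variable [StarOrderedRing A]

theorem norm_le (hP : IsProjection A P) (x : X) : ‖P x‖ ≤ ‖x‖ := by
  have h : ‖P x‖ * ‖P x‖ ≤ ‖x‖ * ‖P x‖ := calc
    ‖P x‖ * ‖P x‖ = ‖inner A x (P x)‖ := by
      rw [← sq, CStarModule.norm_sq_eq A, hP.self_adjoint, hP.idempotent]
    _ ≤ ‖x‖ * ‖P x‖ := CStarModule.norm_inner_le X
  by_contra! hlt
  exact absurd (le_of_mul_le_mul_right h ((norm_nonneg x).trans_lt hlt)) hlt.not_ge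

/-- A projection as a bounded operator. -/
def toContinuousLinearMap (hP : IsProjection A P) : X →L[ℂ] X :=
  LinearMap.mkContinuous ⟨⟨P, hP.map_add⟩, hP.map_smul⟩ 1 fun x => by
    simpa using hP.norm_le x

@[simp]
theorem toContinuousLinearMap_apply (hP : IsProjection A P) (x : X) :
    hP.toContinuousLinearMap x = P x := rfl

end IsProjection

variable {n : ℕ}

theorem hilbertMultiNorm_nonneg (x : Fin n → X) : 0 ≤ hilbertMultiNorm A x :=
  Real.sSup_nonneg <| by rintro _ ⟨P, -, rfl⟩; exact norm_nonneg _

theorem hilbertMultiNorm_le {x : Fin n → X} {c : ℝ} (hc : 0 ≤ c)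
    (h : ∀ P : Fin n → X → X, IsProjectionDecomposition A P → ‖∑ i, P i (x i)‖ ≤ c) :
    hilbertMultiNorm A x ≤ c :=
  Real.sSup_le (by rintro _ ⟨P, hP, rfl⟩; exact h P hP) hc

variable [StarOrderedRing A]

theorem IsProjectionDecomposition.norm_sum_le {P : Fin n → X → X}
    (hP : IsProjectionDecomposition A P) (x : Fin n → X) : ‖∑ i, P i (x i)‖ ≤ ∑ i, ‖x i‖ :=
  norm_sum_le_of_le _ fun i _ => (hP.isProjection i).norm_le (x i)

theorem IsProjectionDecomposition.norm_sum_le_hilbertMultiNorm {P : Fin n → X → X}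
    (hP : IsProjectionDecomposition A P) (x : Fin n → X) :
    ‖∑ i, P i (x i)‖ ≤ hilbertMultiNorm A x :=
  le_csSup ⟨∑ i, ‖x i‖, by rintro _ ⟨Q, hQ, rfl⟩; exact hQ.norm_sum_le x⟩ ⟨P, hP, rfl⟩

theorem hilbertMultiNorm_le_sum_norm (x : Fin n → X) : hilbertMultiNorm A x ≤ ∑ i, ‖x i‖ :=
  hilbertMultiNorm_le (Finset.sum_nonneg fun _ _ => norm_nonneg _) fun _ hP => hP.norm_sum_le x

end CStarModule

section RightModule

variable {A X : Type*} [NonUnitalCStarAlgebra A] [PartialOrder A]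
  [NormedAddCommGroup X] [NormedSpace ℂ X] [SMul Aᵐᵒᵖ X] [CStarModule Aᵐᵒᵖ X]

theorem rinner_op_smul_left (x y : X) (a : A) :
    rinner A (MulOpposite.op a • x) y = star a * rinner A x y := by
  rw [← star_rinner, rinner_op_smul_right, star_mul, star_rinner]

theorem rinner_sub_right (x y z : X) : rinner A x (y - z) = rinner A x y - rinner A x z := by
  simp [rinner]

theorem rinner_sub_left (x y z : X) : rinner A (x - y) z = rinner A x z - rinner A y z := by
  simp [rinner]

variable (A) in
theorem norm_sq_eq_norm_rinner (x : X) : ‖x‖ ^ 2 = ‖rinner A x x‖ :=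
  CStarModule.norm_sq_eq Aᵐᵒᵖ

theorem IsProjection.rinner_eq {P : X → X} (hP : IsProjection Aᵐᵒᵖ P) (x y : X) :
    rinner A (P x) y = rinner A x (P y) :=
  congrArg MulOpposite.unop (hP.self_adjoint x y)

theorem norm_op_smul_le (a : A) (x : X) : ‖MulOpposite.op a • x‖ ≤ ‖x‖ * ‖a‖ := by
  refine le_of_sq_le_sq ?_ (by positivity)
  calc ‖MulOpposite.op a • x‖ ^ 2 = ‖star a * (rinner A x x * a)‖ := by
        rw [norm_sq_eq_norm_rinner A, rinner_op_smul_right, rinner_op_smul_left, mul_assoc]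
    _ ≤ ‖a‖ * (‖rinner A x x‖ * ‖a‖) := by
        rw [← norm_star a]
        exact (norm_mul_le _ _).trans (by rw [norm_star]; gcongr; exact norm_mul_le _ _)
    _ = (‖x‖ * ‖a‖) ^ 2 := by rw [← norm_sq_eq_norm_rinner]; ring

variable [StarOrderedRing A]

theorem norm_rinner_le (x y : X) : ‖rinner A x y‖ ≤ ‖x‖ * ‖y‖ :=
  CStarModule.norm_inner_le (A := Aᵐᵒᵖ) X

end RightModule

/-! ### Compact operators -/

section CompactOperators

variable {H : Type*} [NormedAddCommGroup H] [InnerProductSpace ℂ H]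

theorem isCompactOperator_rankOne (η ξ : H) :
    IsCompactOperator (InnerProductSpace.rankOne ℂ η ξ : H →L[ℂ] H) := by
  rw [InnerProductSpace.rankOne_def']
  exact (isCompactOperator_of_locallyCompactSpace_rng
    (ContinuousLinearMap.toSpanSingleton ℂ η)).comp_clm _

theorem norm_sub_starProjection_apply_le (F : Submodule ℂ H) [FiniteDimensional ℂ F] (η : H)
    {ξ : H} (hξ : ξ ∈ F) : ‖η - F.starProjection η‖ ≤ ‖η - ξ‖ := by
  rw [Submodule.starProjection_minimal]
  exact ciInf_le (f := fun ξ : F => ‖η - ξ‖)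
    ⟨0, by rintro _ ⟨ξ, rfl⟩; exact norm_nonneg _⟩ ⟨ξ, hξ⟩

variable [CompleteSpace H]

namespace CompactOp

theorem ext_apply {a b : CompactOp H} (h : ∀ η : H, (a : H →L[ℂ] H) η = (b : H →L[ℂ] H) η) :
    a = b :=
  Subtype.ext (ContinuousLinearMap.ext h)

theorem nonneg_iff {a : CompactOp H} : 0 ≤ a ↔ (a : H →L[ℂ] H).IsPositive :=
  ContinuousLinearMap.nonneg_iff_isPositive _

instance instStarOrderedRing : StarOrderedRing (CompactOp H) :=
  .of_nonneg_iff' (fun h c => add_le_add_right (α := H →L[ℂ] H) h c) fun a => by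
    refine ⟨fun ha => ?_, ?_⟩
    · replace ha : 0 ≤ (a : H →L[ℂ] H) := ha
      have sqrt_mem : CFC.sqrt (a : H →L[ℂ] H) ∈ compactSubalgebra H := by
        rw [CFC.sqrt_eq_real_sqrt _ ha]
        exact cfcₙ_mem _ a.2
      refine ⟨⟨_, sqrt_mem⟩, Subtype.ext ?_⟩
      change (a : H →L[ℂ] H) = star (CFC.sqrt (a : H →L[ℂ] H)) * CFC.sqrt (a : H →L[ℂ] H)
      rw [(CFC.sqrt_nonneg (a : H →L[ℂ] H)).isSelfAdjoint.star_eq, CFC.sqrt_mul_sqrt_self _ ha]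
    · rintro ⟨b, rfl⟩
      exact star_mul_self_nonneg (b : H →L[ℂ] H)

end CompactOp

/-- The rank-one operator `ζ ↦ ⟨ξ, ζ⟩ η` as an element of `𝕂(H)`. -/
def rankOneOp (η ξ : H) : CompactOp H :=
  ⟨InnerProductSpace.rankOne ℂ η ξ, isCompactOperator_rankOne η ξ⟩

@[simp]
theorem coe_rankOneOp (η ξ : H) :
    (rankOneOp η ξ : H →L[ℂ] H) = InnerProductSpace.rankOne ℂ η ξ := rfl

theorem mul_rankOneOp (a : CompactOp H) (η ξ : H) :
    a * rankOneOp η ξ = rankOneOp ((a : H →L[ℂ] H) η) ξ :=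
  CompactOp.ext_apply fun _ => by simp

theorem rankOneOp_mul (a : CompactOp H) (η ξ : H) :
    rankOneOp η ξ * a = rankOneOp η ((star a : H →L[ℂ] H) ξ) :=
  CompactOp.ext_apply fun _ => by
    simp [ContinuousLinearMap.star_eq_adjoint, ContinuousLinearMap.adjoint_inner_left]

theorem star_rankOneOp (η ξ : H) : star (rankOneOp η ξ) = rankOneOp ξ η :=
  Subtype.ext (by simp [ContinuousLinearMap.star_eq_adjoint])

theorem rankOneOp_add_left (η η' ξ : H) :
    rankOneOp (η + η') ξ = rankOneOp η ξ + rankOneOp η' ξ := Subtype.ext (by simp)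

theorem rankOneOp_smul_left (c : ℂ) (η ξ : H) : rankOneOp (c • η) ξ = c • rankOneOp η ξ :=
  Subtype.ext (by simp)

theorem rankOneOp_sub_left (η η' ξ : H) :
    rankOneOp (η - η') ξ = rankOneOp η ξ - rankOneOp η' ξ := Subtype.ext (by simp)

theorem rankOneOp_sub_right (η ξ ξ' : H) :
    rankOneOp η (ξ - ξ') = rankOneOp η ξ - rankOneOp η ξ' := Subtype.ext (by simp)

theorem rankOneOp_smul_right (c : ℂ) (η ξ : H) :
    rankOneOp η (c • ξ) = star c • rankOneOp η ξ := Subtype.ext (by simp)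

theorem rankOneOp_mul_rankOneOp (η ξ η' ξ' : H) :
    rankOneOp η ξ * rankOneOp η' ξ' = inner ℂ ξ η' • rankOneOp η ξ' := by
  rw [mul_rankOneOp, coe_rankOneOp, InnerProductSpace.rankOne_apply, rankOneOp_smul_left]

theorem star_rankOneOp_mul_rankOneOp {ζ : H} (hζ : ‖ζ‖ = 1) (η ξ : H) :
    star (rankOneOp ζ η) * rankOneOp ζ ξ = rankOneOp η ξ := by
  rw [star_rankOneOp, rankOneOp_mul_rankOneOp, inner_self_eq_norm_sq_to_K, hζ]
  simp

theorem norm_rankOneOp (η ξ : H) : ‖rankOneOp η ξ‖ = ‖η‖ * ‖ξ‖ :=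
  InnerProductSpace.norm_rankOne η ξ

theorem rankOneOp_self_nonneg (η : H) : 0 ≤ rankOneOp η η :=
  CompactOp.nonneg_iff.2 (InnerProductSpace.isPositive_rankOne_self η)

theorem isMinimalProjection_rankOneOp {ζ : H} (hζ : ‖ζ‖ = 1) :
    IsMinimalProjection (rankOneOp ζ ζ) where
  isStarProjection := ⟨by
    simpa [IsIdempotentElem, star_rankOneOp] using star_rankOneOp_mul_rankOneOp hζ ζ ζ,
    star_rankOneOp ζ ζ⟩
  ne_zero h := by simpa [h, hζ] using norm_rankOneOp ζ ζ
  corner a := ⟨inner ℂ ζ ((a : H →L[ℂ] H) ζ), by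
    rw [mul_assoc, mul_rankOneOp, rankOneOp_mul_rankOneOp]⟩

/-- The orthogonal projection onto a finite-dimensional subspace as an element of `𝕂(H)`. -/
def projOp (F : Submodule ℂ H) [FiniteDimensional ℂ F] : CompactOp H :=
  ⟨F.starProjection, (isCompactOperator_of_locallyCompactSpace_rng F.subtypeL).comp_clm
    F.orthogonalProjectionOnto⟩

theorem star_projOp (F : Submodule ℂ H) [FiniteDimensional ℂ F] : star (projOp F) = projOp F :=
  Subtype.ext (isSelfAdjoint_starProjection F)

theorem projOp_eq_sum_rankOneOp (F : Submodule ℂ H) [FiniteDimensional ℂ F] :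
    projOp F = ∑ i, rankOneOp (stdOrthonormalBasis ℂ F i : H) (stdOrthonormalBasis ℂ F i) := by
  apply Subtype.ext
  rw [AddSubmonoidClass.coe_finsetSum]
  exact (stdOrthonormalBasis ℂ F).starProjection_eq_sum_rankOne

theorem exists_norm_sub_projOp_mul_le (a : CompactOp H) {ε : ℝ} (hε : 0 < ε) :
    ∃ (F : Submodule ℂ H) (_ : FiniteDimensional ℂ F), ‖a - projOp F * a‖ ≤ ε := by
  have image_ball : TotallyBounded ((a : H →L[ℂ] H) '' Metric.closedBall (0 : H) 1) :=
    ((IsCompactOperator.isCompact_closure_image_closedBall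
      (f := ((a : H →L[ℂ] H) : H →ₗ[ℂ] H)) a.2 1).totallyBounded).subset subset_closure
  obtain ⟨t, -, t_finite, t_net⟩ := Metric.finite_approx_of_totallyBounded image_ball ε hε
  have := FiniteDimensional.span_of_finite ℂ t_finite
  refine ⟨Submodule.span ℂ t, this, ?_⟩
  refine ContinuousLinearMap.opNorm_le_of_unit_norm (𝕜 := ℂ) (f := (a : H →L[ℂ] H) -
    (Submodule.span ℂ t).starProjection * (a : H →L[ℂ] H)) hε.le fun η hη => ?_
  obtain ⟨ξ, hξ, hηξ⟩ : ∃ ξ ∈ t, (a : H →L[ℂ] H) η ∈ Metric.ball ξ ε := by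
    simpa only [Set.mem_iUnion, exists_prop] using
      t_net (Set.mem_image_of_mem _ (mem_closedBall_zero_iff.2 hη.le))
  exact (norm_sub_starProjection_apply_le _ _ (Submodule.subset_span hξ)).trans
    (mem_ball_iff_norm.1 hηξ).le

theorem dense_span_rankOneOp :
    Dense (Submodule.span ℂ {a : CompactOp H | ∃ η ξ, a = rankOneOp η ξ} : Set (CompactOp H)) := by
  intro a
  rw [Metric.mem_closure_iff]
  intro ε hε
  obtain ⟨F, _, hF⟩ := exists_norm_sub_projOp_mul_le a (half_pos hε)
  refine ⟨projOp F * a, ?_, by rw [dist_eq_norm]; linarith⟩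
  rw [projOp_eq_sum_rankOneOp, Finset.sum_mul]
  exact Submodule.sum_mem _ fun i _ => Submodule.subset_span ⟨_, _, rankOneOp_mul a _ _⟩

end CompactOperators

/-! ### Pure states of the compact operators -/

section PositiveFunctional

variable {A : Type*} [NonUnitalCStarAlgebra A] [PartialOrder A]

theorem PureState.ext_toFunctional {τ σ : PureState A}
    (h : τ.toFunctional = σ.toFunctional) : τ = σ := by
  cases τ; cases σ; cases h; rfl

variable [StarOrderedRing A]

theorem IsPositiveFunctional.norm_apply_star_mul_sq_le {ρ : A →L[ℂ] ℂ}
    (hρ : IsPositiveFunctional ρ) (a b : A) :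
    ‖ρ (star a * b)‖ ^ 2 ≤ (ρ (star a * a)).re * (ρ (star b * b)).re := by
  let f : A →ₚ[ℂ] ℂ := .mk₀ ρ.toLinearMap hρ
  have cauchy_schwarz := InnerProductSpace.Core.inner_mul_inner_self_le
    (c := f.preGNSpreInnerProdSpace) (f.toPreGNS a) (f.toPreGNS b)
  rw [InnerProductSpace.Core.norm_inner_symm (c := f.preGNSpreInnerProdSpace) (f.toPreGNS b)]
    at cauchy_schwarz
  rw [sq]
  exact cauchy_schwarz

end PositiveFunctional

section VectorState

variable {H : Type*} [NormedAddCommGroup H] [InnerProductSpace ℂ H] [CompleteSpace H]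

theorem functional_ext_rankOneOp {ρ σ : CompactOp H →L[ℂ] ℂ}
    (h : ∀ η ξ, ρ (rankOneOp η ξ) = σ (rankOneOp η ξ)) : ρ = σ := by
  refine ContinuousLinearMap.ext_on dense_span_rankOneOp ?_
  rintro _ ⟨η, ξ, rfl⟩
  exact h η ξ

theorem star_mul_projOp_mul_eq_sum (b : CompactOp H) (F : Submodule ℂ H) [FiniteDimensional ℂ F] :
    star b * (projOp F * b) = ∑ i, rankOneOp ((star b : H →L[ℂ] H) (stdOrthonormalBasis ℂ F i))
      ((star b : H →L[ℂ] H) (stdOrthonormalBasis ℂ F i)) := by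
  simp only [projOp_eq_sum_rankOneOp, Finset.sum_mul, Finset.mul_sum, rankOneOp_mul]
  exact Finset.sum_congr rfl fun i _ => mul_rankOneOp _ _ _

theorem isPositiveFunctional_of_rankOneOp {ρ : CompactOp H →L[ℂ] ℂ}
    (h : ∀ η, 0 ≤ ρ (rankOneOp η η)) : IsPositiveFunctional ρ := by
  intro a ha
  obtain ⟨b, rfl⟩ := CStarAlgebra.nonneg_iff_eq_star_mul_self.1 ha
  have isClosed_nonneg : IsClosed {a : CompactOp H | 0 ≤ ρ a} :=
    isClosed_le continuous_const ρ.continuous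
  refine isClosed_nonneg.closure_subset (Metric.mem_closure_iff.2 fun ε hε => ?_)
  obtain ⟨F, _, hF⟩ := exists_norm_sub_projOp_mul_le b (ε := ε / (‖b‖ + 1)) (by positivity)
  refine ⟨star b * (projOp F * b), ?_, ?_⟩
  · rw [Set.mem_ofPred_eq, star_mul_projOp_mul_eq_sum, map_sum]
    exact Finset.sum_nonneg fun i _ => h _
  · calc dist (star b * b) (star b * (projOp F * b))
        = ‖star b * (b - projOp F * b)‖ := by rw [dist_eq_norm, mul_sub]
      _ ≤ ‖b‖ * (ε / (‖b‖ + 1)) := by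
        exact (norm_mul_le _ _).trans
          (mul_le_mul (norm_star b).le hF (norm_nonneg _) (norm_nonneg _))
      _ < ε := by
        rw [mul_div_assoc', div_lt_iff₀ (by positivity), mul_comm]
        gcongr
        linarith

namespace IsPositiveFunctional

variable {ρ : CompactOp H →L[ℂ] ℂ}

theorem apply_rankOneOp_self_eq_re (hρ : IsPositiveFunctional ρ) (η : H) :
    ρ (rankOneOp η η) = ((ρ (rankOneOp η η)).re : ℂ) :=
  Complex.eq_re_of_ofReal_le (hρ _ (rankOneOp_self_nonneg η))

theorem norm_apply_rankOneOp_sq_le (hρ : IsPositiveFunctional ρ) (η ξ : H) :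
    ‖ρ (rankOneOp η ξ)‖ ^ 2 ≤ (ρ (rankOneOp η η)).re * (ρ (rankOneOp ξ ξ)).re := by
  rcases subsingleton_or_nontrivial H with _ | _
  · rw [Subsingleton.elim η ξ, hρ.apply_rankOneOp_self_eq_re]
    simp [sq]
  · obtain ⟨ζ, hζ⟩ := exists_norm_eq H zero_le_one
    simpa only [star_rankOneOp_mul_rankOneOp hζ] using
      hρ.norm_apply_star_mul_sq_le (rankOneOp ζ η) (rankOneOp ζ ξ)

theorem apply_rankOneOp_eq_zero_of_left (hρ : IsPositiveFunctional ρ) {η : H}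
    (h : ρ (rankOneOp η η) = 0) (ξ : H) : ρ (rankOneOp η ξ) = 0 := by
  simpa [h] using hρ.norm_apply_rankOneOp_sq_le η ξ

theorem apply_rankOneOp_eq_zero_of_right (hρ : IsPositiveFunctional ρ) {ξ : H}
    (h : ρ (rankOneOp ξ ξ) = 0) (η : H) : ρ (rankOneOp η ξ) = 0 := by
  simpa [h] using hρ.norm_apply_rankOneOp_sq_le η ξ

end IsPositiveFunctional

/-- The functional `a ↦ ⟨ζ, a ζ⟩` on `𝕂(H)`. -/
def vectorFunctional (ζ : H) : CompactOp H →L[ℂ] ℂ :=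
  LinearMap.mkContinuous
    { toFun a := inner ℂ ζ ((a : H →L[ℂ] H) ζ)
      map_add' a b := by simp
      map_smul' c a := by simp } (‖ζ‖ ^ 2) fun a => by
    refine (norm_inner_le_norm _ _).trans ?_
    have : ‖(a : H →L[ℂ] H) ζ‖ ≤ ‖a‖ * ‖ζ‖ := (a : H →L[ℂ] H).le_opNorm ζ
    nlinarith [norm_nonneg ζ]

theorem vectorFunctional_apply (ζ : H) (a : CompactOp H) :
    vectorFunctional ζ a = inner ℂ ζ ((a : H →L[ℂ] H) ζ) := rfl

theorem vectorFunctional_rankOneOp (ζ η ξ : H) :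
    vectorFunctional ζ (rankOneOp η ξ) = inner ℂ ξ ζ * inner ℂ ζ η := by
  simp [vectorFunctional_apply]

theorem vectorFunctional_rankOneOp_self (ζ η : H) :
    vectorFunctional ζ (rankOneOp η η) = ((‖inner ℂ ζ η‖ ^ 2 : ℝ) : ℂ) := by
  rw [vectorFunctional_rankOneOp, ← inner_conj_symm, Complex.conj_mul', Complex.ofReal_pow]

theorem vectorFunctional_smul (c : ℂ) (ζ : H) :
    vectorFunctional (c • ζ) = ((‖c‖ ^ 2 : ℝ) : ℂ) • vectorFunctional ζ := by
  ext a
  simp only [vectorFunctional_apply, map_smul, inner_smul_left, inner_smul_right, smul_apply,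
    smul_eq_mul, Complex.ofReal_pow, ← Complex.conj_mul']
  ring

theorem norm_vectorFunctional (ζ : H) : ‖vectorFunctional ζ‖ = ‖ζ‖ ^ 2 := by
  refine le_antisymm (LinearMap.mkContinuous_norm_le _ (by positivity) _) ?_
  rcases eq_or_ne ζ 0 with rfl | hζ
  · simp [ContinuousLinearMap.opNorm_nonneg]
  · have h := (vectorFunctional ζ).le_opNorm (rankOneOp ζ ζ)
    rw [vectorFunctional_rankOneOp_self, norm_rankOneOp, inner_self_eq_norm_sq_to_K] at h
    refine le_of_mul_le_mul_right (a := ‖ζ‖ * ‖ζ‖) ?_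
      (mul_pos (norm_pos_iff.2 hζ) (norm_pos_iff.2 hζ))
    simpa [pow_succ, mul_assoc] using h

theorem isPositiveFunctional_vectorFunctional (ζ : H) :
    IsPositiveFunctional (vectorFunctional ζ) :=
  fun _ ha => (CompactOp.nonneg_iff.1 ha).inner_nonneg_right ζ

theorem IsPositiveFunctional.eq_smul_vectorFunctional {ρ : CompactOp H →L[ℂ] ℂ}
    (hρ : IsPositiveFunctional ρ) {ζ : H} (hζ : ‖ζ‖ = 1)
    (h : ∀ η, inner ℂ ζ η = 0 → ρ (rankOneOp η η) = 0) :
    ρ = ρ (rankOneOp ζ ζ) • vectorFunctional ζ := by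
  have inner_sub (η : H) : inner ℂ ζ (η - inner ℂ ζ η • ζ) = 0 := by simp [hζ]
  refine functional_ext_rankOneOp fun η ξ => ?_
  have left : ρ (rankOneOp η ξ) = inner ℂ ζ η * ρ (rankOneOp ζ ξ) := by
    simpa [rankOneOp_sub_left, rankOneOp_smul_left, sub_eq_zero] using
      hρ.apply_rankOneOp_eq_zero_of_left (h _ (inner_sub η)) ξ
  have right : ρ (rankOneOp ζ ξ) = inner ℂ ξ ζ * ρ (rankOneOp ζ ζ) := by
    simpa [rankOneOp_sub_right, rankOneOp_smul_right, sub_eq_zero] using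
      hρ.apply_rankOneOp_eq_zero_of_right (h _ (inner_sub ξ)) ζ
  rw [left, right, smul_apply, vectorFunctional_rankOneOp, smul_eq_mul]
  ring

/-- The pure state `a ↦ ⟨ζ, a ζ⟩` of `𝕂(H)` defined by a unit vector `ζ`. -/
def vectorState (ζ : H) (hζ : ‖ζ‖ = 1) : PureState (CompactOp H) where
  toFunctional := vectorFunctional ζ
  positive := isPositiveFunctional_vectorFunctional ζ
  norm_eq_one := by rw [norm_vectorFunctional, hζ, one_pow]
  pure ρ hρ hle := by
    have rho_le (η : H) : (ρ (rankOneOp η η)).re ≤ ‖inner ℂ ζ η‖ ^ 2 := by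
      have := (Complex.nonneg_iff.1 (hle _ (rankOneOp_self_nonneg η))).1
      rw [sub_apply, vectorFunctional_rankOneOp_self, Complex.sub_re, Complex.ofReal_re] at this
      linarith
    have rho_nonneg (η : H) : 0 ≤ (ρ (rankOneOp η η)).re :=
      (Complex.nonneg_iff.1 (hρ _ (rankOneOp_self_nonneg η))).1
    refine ⟨(ρ (rankOneOp ζ ζ)).re, rho_nonneg ζ, by simpa [hζ] using rho_le ζ, ?_⟩
    rw [← hρ.apply_rankOneOp_self_eq_re]
    refine hρ.eq_smul_vectorFunctional hζ fun η hη => ?_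
    rw [hρ.apply_rankOneOp_self_eq_re, le_antisymm (by simpa [hη] using rho_le η) (rho_nonneg η),
      Complex.ofReal_zero]

theorem vectorState_toFunctional (ζ : H) (hζ : ‖ζ‖ = 1) :
    (vectorState ζ hζ).toFunctional = vectorFunctional ζ := rfl

theorem exists_inner_eq_apply_rankOneOp (ρ : CompactOp H →L[ℂ] ℂ) (v : H) :
    ∃ w : H, ∀ η, inner ℂ w η = ρ (rankOneOp η v) := by
  let f : H →L[ℂ] ℂ := LinearMap.mkContinuous
    { toFun η := ρ (rankOneOp η v)
      map_add' η η' := by rw [rankOneOp_add_left, map_add]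
      map_smul' c η := by rw [rankOneOp_smul_left, map_smul, RingHom.id_apply] }
    (‖ρ‖ * ‖v‖) fun η => by
      exact (ρ.le_opNorm (rankOneOp η v)).trans_eq (by rw [norm_rankOneOp]; ring)
  exact ⟨(InnerProductSpace.toDual ℂ H).symm f, fun η => InnerProductSpace.toDual_symm_apply⟩

theorem IsPositiveFunctional.exists_apply_rankOneOp_self_eq_one {ρ : CompactOp H →L[ℂ] ℂ}
    (hρ : IsPositiveFunctional ρ) (hne : ρ ≠ 0) : ∃ v, ρ (rankOneOp v v) = 1 := by
  obtain ⟨v, hv⟩ : ∃ v, ρ (rankOneOp v v) ≠ 0 := by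
    by_contra! h
    exact hne (functional_ext_rankOneOp fun η ξ => hρ.apply_rankOneOp_eq_zero_of_left (h η) ξ)
  have hv_pos : 0 < (ρ (rankOneOp v v)).re :=
    (Complex.pos_iff.1 ((hρ _ (rankOneOp_self_nonneg v)).lt_of_ne' hv)).1
  refine ⟨((√(ρ (rankOneOp v v)).re)⁻¹ : ℂ) • v, ?_⟩
  rw [rankOneOp_smul_left, rankOneOp_smul_right, map_smul, map_smul, smul_smul, smul_eq_mul]
  nth_rw 3 [hρ.apply_rankOneOp_self_eq_re]
  rw [Complex.star_def, map_inv₀, Complex.conj_ofReal, ← mul_inv, ← Complex.ofReal_mul,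
    Real.mul_self_sqrt hv_pos.le, inv_mul_cancel₀ (by exact_mod_cast hv_pos.ne')]

theorem IsPositiveFunctional.exists_vectorFunctional_le {ρ : CompactOp H →L[ℂ] ℂ}
    (hρ : IsPositiveFunctional ρ) (hne : ρ ≠ 0) :
    ∃ w : H, w ≠ 0 ∧ IsPositiveFunctional (ρ - vectorFunctional w) := by
  obtain ⟨v, hv⟩ := hρ.exists_apply_rankOneOp_self_eq_one hne
  obtain ⟨w, hw⟩ := exists_inner_eq_apply_rankOneOp ρ v
  refine ⟨w, ?_, isPositiveFunctional_of_rankOneOp fun η => ?_⟩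
  · rintro rfl
    simpa [hv] using hw v
  · rw [sub_apply, hρ.apply_rankOneOp_self_eq_re, vectorFunctional_rankOneOp_self, hw,
      ← Complex.ofReal_sub, Complex.zero_le_real, sub_nonneg]
    simpa [hv] using hρ.norm_apply_rankOneOp_sq_le η v

theorem exists_eq_vectorState (τ : PureState (CompactOp H)) :
    ∃ (ζ : H) (hζ : ‖ζ‖ = 1), τ = vectorState ζ hζ := by
  have hne : τ.toFunctional ≠ 0 := fun h => by simpa [h] using τ.norm_eq_one
  obtain ⟨w, w_ne, hw⟩ := τ.positive.exists_vectorFunctional_le hne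
  obtain ⟨t, t_nonneg, -, ht⟩ := τ.pure _ (isPositiveFunctional_vectorFunctional w) hw
  have t_ne : t ≠ 0 := by
    rintro rfl
    have := DFunLike.congr_fun ht (rankOneOp w w)
    rw [vectorFunctional_rankOneOp_self, smul_apply] at this
    simp [w_ne] at this
  have scaled : vectorFunctional (((√t)⁻¹ : ℂ) • w) = τ.toFunctional := by
    rw [vectorFunctional_smul, ht, smul_smul, norm_inv, Complex.norm_real, Real.norm_eq_abs,
      inv_pow, sq_abs, Real.sq_sqrt t_nonneg, ← Complex.ofReal_mul, inv_mul_cancel₀ t_ne,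
      Complex.ofReal_one, one_smul]
  have norm_scaled : ‖((√t)⁻¹ : ℂ) • w‖ = 1 := by
    rw [← sq_eq_sq₀ (norm_nonneg _) zero_le_one, ← norm_vectorFunctional, scaled,
      τ.norm_eq_one, one_pow]
  exact ⟨_, norm_scaled, PureState.ext_toFunctional scaled.symm⟩

end VectorState

/-! ### Localizations -/

section Localization

variable {A : Type*} [NonUnitalCStarAlgebra A] [PartialOrder A] (τ : PureState A)
  {X : Type*} [NormedAddCommGroup X] [NormedSpace ℂ X] [SMul Aᵐᵒᵖ X] [CStarModule Aᵐᵒᵖ X]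

theorem toLocalization_add (x y : X) :
    toLocalization τ (x + y) = toLocalization τ x + toLocalization τ y :=
  UniformSpace.Completion.coe_add (α := PreLocalization τ X) x y

theorem toLocalization_smul (c : ℂ) (x : X) :
    toLocalization τ (c • x) = c • toLocalization τ x :=
  UniformSpace.Completion.coe_smul (X := PreLocalization τ X) c x

theorem denseRange_toLocalization : DenseRange (toLocalization τ : X → Localization τ X) :=
  UniformSpace.Completion.denseRange_coe (α := PreLocalization τ X)

variable (X) in
/-- The canonical map from `X` to its localization, as a linear map. -/
def toLocalizationₗ : X →ₗ[ℂ] Localization τ X where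
  toFun := toLocalization τ
  map_add' := toLocalization_add τ
  map_smul' := toLocalization_smul τ

end Localization

/-! ### Modules over the compact operators as spaces of operators -/

section OperatorModel

variable {H : Type*} [NormedAddCommGroup H] [InnerProductSpace ℂ H] [CompleteSpace H]
  {X : Type*} [NormedAddCommGroup X] [NormedSpace ℂ X]
  [SMul (CompactOp H)ᵐᵒᵖ X] [CStarModule (CompactOp H)ᵐᵒᵖ X]

theorem exists_norm_sub_projOp_smul_le (x : X) {ε : ℝ} (hε : 0 < ε) :
    ∃ (F : Submodule ℂ H) (_ : FiniteDimensional ℂ F),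
      ‖x - MulOpposite.op (projOp F) • x‖ ≤ ε := by
  obtain ⟨F, hF, h⟩ := exists_norm_sub_projOp_mul_le (rinner (CompactOp H) x x)
    (show 0 < ε ^ 2 / 2 by positivity)
  refine ⟨F, hF, le_of_sq_le_sq ?_ hε.le⟩
  set r := rinner (CompactOp H) x x
  have norm_projOp_le : ‖projOp F‖ ≤ 1 := F.starProjection_norm_le
  calc ‖x - MulOpposite.op (projOp F) • x‖ ^ 2
      = ‖(r - projOp F * r) - (r - projOp F * r) * projOp F‖ := by
        rw [norm_sq_eq_norm_rinner (CompactOp H), rinner_sub_left, rinner_sub_right,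
          rinner_sub_right, rinner_op_smul_left, rinner_op_smul_left, rinner_op_smul_right,
          star_projOp, sub_mul, mul_assoc, sub_sub_sub_comm]
    _ ≤ ‖r - projOp F * r‖ + ‖r - projOp F * r‖ * ‖projOp F‖ :=
        (norm_sub_le _ _).trans (by gcongr; exact norm_mul_le _ _)
    _ ≤ ε ^ 2 / 2 + ε ^ 2 / 2 * 1 := by gcongr
    _ = ε ^ 2 := by ring

variable (H X) in
/-- A realization of a right Hilbert `𝕂(H)`-module `X` as a space of operators from `H` to a Hilbert
space `K`, with `⟨x, y⟩ = T_x⋆ T_y`, that contains all operators of rank one. -/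
structure OperatorModel (K : Type*) [NormedAddCommGroup K] [InnerProductSpace ℂ K] where
  toOp : X →ₗᵢ[ℂ] (H →L[ℂ] K)
  inner_toOp : ∀ x y η ξ, inner ℂ (toOp x η) (toOp y ξ) =
    inner ℂ η ((rinner (CompactOp H) x y : H →L[ℂ] H) ξ)
  exists_toOp_eq_rankOne : ∀ k η, ∃ x, toOp x = InnerProductSpace.rankOne ℂ k η

/-- The linear map `L` presents the Hilbert space `K` as the localization of `X` at the vector state
of the unit vector `ζ`. -/
structure IsVectorLocalization (ζ : H) {K : Type*} [NormedAddCommGroup K] [InnerProductSpace ℂ K]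
    (L : X →ₗ[ℂ] K) : Prop where
  norm_eq_one : ‖ζ‖ = 1
  inner_map : ∀ x y, inner ℂ (L x) (L y) = vectorFunctional ζ (rinner (CompactOp H) x y)
  denseRange : DenseRange L

theorem isVectorLocalization_toLocalizationₗ {ζ : H} (hζ : ‖ζ‖ = 1) :
    IsVectorLocalization ζ (toLocalizationₗ (vectorState ζ hζ) X) where
  norm_eq_one := hζ
  inner_map x y := inner_toLocalization _ _ x y
  denseRange := denseRange_toLocalization _

namespace IsVectorLocalization

variable {ζ : H} {K : Type*} [NormedAddCommGroup K] [InnerProductSpace ℂ K] {L : X →ₗ[ℂ] K}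
  (hL : IsVectorLocalization ζ L)

include hL

theorem norm_map_le (x : X) : ‖L x‖ ≤ ‖x‖ := by
  refine le_of_sq_le_sq ?_ (norm_nonneg x)
  calc ‖L x‖ ^ 2 = ‖vectorFunctional ζ (rinner (CompactOp H) x x)‖ := by
        rw [← hL.inner_map, inner_self_eq_norm_sq_to_K]
        simp
    _ ≤ ‖vectorFunctional ζ‖ * ‖rinner (CompactOp H) x x‖ := (vectorFunctional ζ).le_opNorm _
    _ = ‖x‖ ^ 2 := by
        rw [norm_vectorFunctional, hL.norm_eq_one, one_pow, one_mul,
          norm_sq_eq_norm_rinner (CompactOp H)]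

theorem map_rankOneOp_smul_self (x : X) : L (MulOpposite.op (rankOneOp ζ ζ) • x) = L x := by
  rw [← sub_eq_zero, ← map_sub, ← inner_self_eq_zero (𝕜 := ℂ), hL.inner_map, rinner_sub_left,
    rinner_sub_right, rinner_sub_right, rinner_op_smul_left, rinner_op_smul_left,
    rinner_op_smul_right, star_rankOneOp, ← mul_assoc]
  simp [vectorFunctional_apply, hL.norm_eq_one]

theorem inner_map_rankOneOp_smul (x y : X) (η ξ : H) :
    inner ℂ (L (MulOpposite.op (rankOneOp η ζ) • x)) (L (MulOpposite.op (rankOneOp ξ ζ) • y)) =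
      inner ℂ η ((rinner (CompactOp H) x y : H →L[ℂ] H) ξ) := by
  rw [hL.inner_map, rinner_op_smul_left, rinner_op_smul_right, star_rankOneOp,
    mul_rankOneOp, rankOneOp_mul_rankOneOp, map_smul, vectorFunctional_rankOneOp_self]
  simp [hL.norm_eq_one]

/-- The operators `η ↦ L (x |η⟩⟨ζ|)` from `H` to `K`, as a function of `x`. -/
def op : X →L[ℂ] H →L[ℂ] K :=
  LinearMap.mkContinuous₂
    (LinearMap.mk₂ ℂ (fun x η => L (MulOpposite.op (rankOneOp η ζ) • x))
      (fun x y η => by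
        simp only [← algebraSMul_apply (A := (CompactOp H)ᵐᵒᵖ), map_add])
      (fun c x η => by
        simp only [← algebraSMul_apply (A := (CompactOp H)ᵐᵒᵖ), map_smul])
      (fun x η ξ => by
        simp only [← algebraSMul_apply (A := (CompactOp H)ᵐᵒᵖ), rankOneOp_add_left,
          MulOpposite.op_add, map_add, LinearMap.add_apply])
      (fun c x η => by
        simp only [← algebraSMul_apply (A := (CompactOp H)ᵐᵒᵖ), rankOneOp_smul_left,
          MulOpposite.op_smul, map_smul, LinearMap.smul_apply])) 1 fun x η => by
    refine ((hL.norm_map_le _).trans (norm_op_smul_le _ _)).trans_eq ?_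
    rw [norm_rankOneOp, hL.norm_eq_one, one_mul, mul_one]

theorem op_apply (x : X) (η : H) : hL.op x η = L (MulOpposite.op (rankOneOp η ζ) • x) := rfl

theorem op_apply_self (x : X) : hL.op x ζ = L x := hL.map_rankOneOp_smul_self x

theorem op_rankOneOp_smul (x : X) (ξ : H) :
    hL.op (MulOpposite.op (rankOneOp ζ ξ) • x) = InnerProductSpace.rankOne ℂ (L x) ξ := by
  refine ContinuousLinearMap.ext fun η => ?_
  rw [op_apply, ← mul_smul_algebra, ← MulOpposite.op_mul, rankOneOp_mul_rankOneOp,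
    InnerProductSpace.rankOne_apply, ← hL.map_rankOneOp_smul_self x, ← map_smul]
  exact congrArg L ((algebraSMul (CompactOp H)ᵐᵒᵖ X).map_smul₂ _ _ x)

variable [CompleteSpace K]

theorem norm_op_apply (x : X) : ‖hL.op x‖ = ‖x‖ := by
  have adjoint_comp_self : ContinuousLinearMap.adjoint (hL.op x) ∘L hL.op x =
      (rinner (CompactOp H) x x : H →L[ℂ] H) := by
    refine ContinuousLinearMap.ext fun η => ext_inner_left ℂ fun ξ => ?_
    rw [ContinuousLinearMap.comp_apply, ContinuousLinearMap.adjoint_inner_right]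
    exact hL.inner_map_rankOneOp_smul x x ξ η
  rw [← sq_eq_sq₀ (norm_nonneg _) (norm_nonneg _), norm_sq_eq_norm_rinner (CompactOp H) x, sq,
    ← ContinuousLinearMap.norm_adjoint_comp_self, adjoint_comp_self]
  rfl

/-- The realization of `X` on its localization at a vector state. -/
def operatorModel [CompleteSpace X] : OperatorModel H X K where
  toOp := { hL.op with norm_map' := hL.norm_op_apply }
  inner_toOp := hL.inner_map_rankOneOp_smul
  exists_toOp_eq_rankOne k ξ := by
    have isClosed_range : IsClosed (Set.range hL.op) :=
      (AddMonoidHomClass.isometry_of_norm hL.op hL.norm_op_apply).isClosedEmbedding.isClosed_range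
    refine hL.denseRange.induction_on
      (p := fun k => InnerProductSpace.rankOne ℂ k ξ ∈ Set.range hL.op) k
      (isClosed_range.preimage (by fun_prop)) fun x => ⟨_, hL.op_rankOneOp_smul x ξ⟩

theorem operatorModel_toOp_apply_self [CompleteSpace X] (x : X) :
    hL.operatorModel.toOp x ζ = L x :=
  hL.op_apply_self x

end IsVectorLocalization

namespace OperatorModel

variable {K : Type*} [NormedAddCommGroup K] [InnerProductSpace ℂ K] (M : OperatorModel H X K)
  {ζ : H}

theorem exists_toOp_apply_eq (hζ : ‖ζ‖ = 1) (k : K) : ∃ x, M.toOp x ζ = k := by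
  obtain ⟨x, hx⟩ := M.exists_toOp_eq_rankOne k ζ
  exact ⟨x, by simp [hx, hζ]⟩

theorem toOp_op_smul (a : CompactOp H) (x : X) :
    M.toOp (MulOpposite.op a • x) = M.toOp x ∘L (a : H →L[ℂ] H) := by
  refine ContinuousLinearMap.ext fun η => ?_
  rw [ContinuousLinearMap.comp_apply, ← sub_eq_zero, ← inner_self_eq_zero (𝕜 := ℂ)]
  simp only [inner_sub_left, inner_sub_right, inner_toOp, rinner_op_smul_left,
    rinner_op_smul_right, MulMemClass.coe_mul, mul_apply_eq_comp]
  have adjoint_left (ξ : H) : inner ℂ η ((↑(star a) : H →L[ℂ] H) ξ) =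
      inner ℂ ((a : H →L[ℂ] H) η) ξ :=
    ContinuousLinearMap.adjoint_inner_right (a : H →L[ℂ] H) η ξ
  rw [adjoint_left, sub_self]

theorem toOp_rankOneOp_smul (x : X) (η ξ : H) :
    M.toOp (MulOpposite.op (rankOneOp η ξ) • x) = InnerProductSpace.rankOne ℂ (M.toOp x η) ξ := by
  rw [toOp_op_smul, coe_rankOneOp, InnerProductSpace.comp_rankOne]

theorem norm_toOp_apply_le (x : X) (hζ : ‖ζ‖ = 1) : ‖M.toOp x ζ‖ ≤ ‖x‖ := by
  simpa [hζ] using (M.toOp x).le_opNorm ζ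

theorem norm_le_of_forall_toOp {x : X} {c : ℝ} (hc : 0 ≤ c)
    (h : ∀ η : H, ‖η‖ = 1 → ‖M.toOp x η‖ ≤ c) : ‖x‖ ≤ c := by
  rw [← M.toOp.norm_map]
  exact ContinuousLinearMap.opNorm_le_of_unit_norm (𝕜 := ℂ) hc h

theorem exists_toOp_eq_comp [CompleteSpace X] (T : K →L[ℂ] K) (x : X) :
    ∃ y, M.toOp y = T ∘L M.toOp x := by
  have isClosed_range : IsClosed (Set.range M.toOp) :=
    M.toOp.isometry.isClosedEmbedding.isClosed_range
  have isClosed_preimage : IsClosed {x : X | T ∘L M.toOp x ∈ Set.range M.toOp} :=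
    isClosed_range.preimage
      ((ContinuousLinearMap.compL ℂ H K K T).continuous.comp M.toOp.continuous)
  refine isClosed_preimage.closure_subset (Metric.mem_closure_iff.2 fun ε hε => ?_)
  obtain ⟨F, _, hF⟩ := exists_norm_sub_projOp_smul_le (H := H) x (half_pos hε)
  refine ⟨MulOpposite.op (projOp F) • x, ?_, by rw [dist_eq_norm]; linarith⟩
  choose y hy using fun i => M.exists_toOp_eq_rankOne
    (T (M.toOp x (stdOrthonormalBasis ℂ F i))) (stdOrthonormalBasis ℂ F i : H)
  refine ⟨∑ i, y i, ?_⟩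
  rw [map_sum, toOp_op_smul, projOp_eq_sum_rankOneOp, AddSubmonoidClass.coe_finsetSum,
    ContinuousLinearMap.comp_finsetSum, ContinuousLinearMap.comp_finsetSum]
  exact Finset.sum_congr rfl fun i _ => by
    rw [hy, coe_rankOneOp, InnerProductSpace.comp_rankOne, InnerProductSpace.comp_rankOne]

end OperatorModel

end OperatorModel

/-! ### Transfer of projection decompositions -/

section Transfer

variable {H : Type*} [NormedAddCommGroup H] [InnerProductSpace ℂ H] [CompleteSpace H]
  {X : Type*} [NormedAddCommGroup X] [NormedSpace ℂ X]
  [SMul (CompactOp H)ᵐᵒᵖ X] [CStarModule (CompactOp H)ᵐᵒᵖ X]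

namespace OperatorModel

variable {K : Type*} [NormedAddCommGroup K] [InnerProductSpace ℂ K] (M : OperatorModel H X K)
  {ζ : H} {n : ℕ}

theorem isProjection_of_toOp_apply {P : X → X} {Q : K → K} (hQ : IsProjection ℂ Q)
    (h : ∀ x η, M.toOp (P x) η = Q (M.toOp x η)) : IsProjection (CompactOp H)ᵐᵒᵖ P where
  self_adjoint x y := by
    refine MulOpposite.unop_injective (CompactOp.ext_apply fun η => ext_inner_left ℂ fun ξ => ?_)
    calc inner ℂ ξ ((rinner (CompactOp H) (P x) y : H →L[ℂ] H) η)
        = inner ℂ (Q (M.toOp x ξ)) (M.toOp y η) := by rw [← M.inner_toOp, h]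
      _ = inner ℂ (M.toOp x ξ) (Q (M.toOp y η)) := hQ.self_adjoint _ _
      _ = inner ℂ ξ ((rinner (CompactOp H) x (P y) : H →L[ℂ] H) η) := by rw [← M.inner_toOp, h]
  idempotent x := M.toOp.injective <| ContinuousLinearMap.ext fun η => by
    rw [h, h, hQ.idempotent]

theorem isProjectionDecomposition_of_toOp_apply {P : Fin n → X → X} {Q : Fin n → K → K}
    (hQ : IsProjectionDecomposition ℂ Q) (h : ∀ i x η, M.toOp (P i x) η = Q i (M.toOp x η)) :
    IsProjectionDecomposition (CompactOp H)ᵐᵒᵖ P where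
  isProjection i := M.isProjection_of_toOp_apply (hQ.isProjection i) (h i)
  orthogonal i j hij x := M.toOp.injective <| ContinuousLinearMap.ext fun η => by
    rw [h, h, hQ.orthogonal i j hij, map_zero, zero_apply]
  sum_eq x := M.toOp.injective <| ContinuousLinearMap.ext fun η => by
    simp only [map_sum, sum_apply, h, hQ.sum_eq]

theorem exists_lifted_decomposition [CompleteSpace X] {Q : Fin n → K → K}
    (hQ : IsProjectionDecomposition ℂ Q) :
    ∃ P : Fin n → X → X, IsProjectionDecomposition (CompactOp H)ᵐᵒᵖ P ∧
      ∀ i x η, M.toOp (P i x) η = Q i (M.toOp x η) := by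
  choose P hP using fun i => M.exists_toOp_eq_comp (hQ.isProjection i).toContinuousLinearMap
  have toOp_P (i x η) : M.toOp (P i x) η = Q i (M.toOp x η) := by simp [hP]
  exact ⟨P, M.isProjectionDecomposition_of_toOp_apply hQ toOp_P, toOp_P⟩

theorem exists_induced_map (hζ : ‖ζ‖ = 1) {P : X → X} (hP : IsProjection (CompactOp H)ᵐᵒᵖ P) :
    ∃ Q : K → K, ∀ x η, M.toOp (P x) η = Q (M.toOp x η) := by
  choose r hr using fun k => M.exists_toOp_eq_rankOne k ζ
  refine ⟨fun k => M.toOp (P (r k)) ζ, fun x η => ?_⟩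
  have r_toOp : r (M.toOp x η) = MulOpposite.op (rankOneOp η ζ) • x :=
    M.toOp.injective (by rw [hr, toOp_rankOneOp_smul])
  change _ = M.toOp (P (r (M.toOp x η))) ζ
  rw [r_toOp, hP.map_smul_algebra, toOp_rankOneOp_smul]
  simp [hζ]

theorem isProjectionDecomposition_induced (hζ : ‖ζ‖ = 1) {P : Fin n → X → X} {Q : Fin n → K → K}
    (hP : IsProjectionDecomposition (CompactOp H)ᵐᵒᵖ P)
    (h : ∀ i x η, M.toOp (P i x) η = Q i (M.toOp x η)) : IsProjectionDecomposition ℂ Q where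
  isProjection i := by
    refine ⟨fun k l => ?_, fun k => ?_⟩ <;> obtain ⟨x, rfl⟩ := M.exists_toOp_apply_eq hζ k
    · obtain ⟨y, rfl⟩ := M.exists_toOp_apply_eq hζ l
      rw [← h, ← h]
      exact (M.inner_toOp _ _ _ _).trans
        (((hP.isProjection i).rinner_eq x y ▸ (M.inner_toOp _ _ _ _).symm))
    · rw [← h, ← h, (hP.isProjection i).idempotent]
  orthogonal i j hij k := by
    obtain ⟨x, rfl⟩ := M.exists_toOp_apply_eq hζ k
    rw [← h, ← h, hP.orthogonal i j hij, map_zero, zero_apply]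
  sum_eq k := by
    obtain ⟨x, rfl⟩ := M.exists_toOp_apply_eq hζ k
    simp only [← h, ← sum_apply, ← map_sum, hP.sum_eq]

theorem norm_toOp_sum_apply_le (hζ : ‖ζ‖ = 1) {P : Fin n → X → X}
    (hP : IsProjectionDecomposition (CompactOp H)ᵐᵒᵖ P) (x : Fin n → X) (η : H) :
    ‖M.toOp (∑ i, P i (x i)) η‖ ≤ hilbertMultiNorm ℂ fun i => M.toOp (x i) η := by
  choose Q hQ using fun i => M.exists_induced_map hζ (hP.isProjection i)
  rw [map_sum, sum_apply]
  simp only [hQ]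
  exact (M.isProjectionDecomposition_induced hζ hP hQ).norm_sum_le_hilbertMultiNorm _

theorem hilbertMultiNorm_toOp_le [CompleteSpace X] (hζ : ‖ζ‖ = 1) (x : Fin n → X) :
    hilbertMultiNorm ℂ (fun i => M.toOp (x i) ζ) ≤ hilbertMultiNorm (CompactOp H)ᵐᵒᵖ x :=
  hilbertMultiNorm_le (hilbertMultiNorm_nonneg x) fun Q hQ => by
    obtain ⟨P, hP, toOp_P⟩ := M.exists_lifted_decomposition hQ
    simp only [← toOp_P, ← sum_apply, ← map_sum]
    exact (M.norm_toOp_apply_le _ hζ).trans (hP.norm_sum_le_hilbertMultiNorm x)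

end OperatorModel

variable {n : ℕ}

variable (H) in
theorem eq_zero_of_subsingleton [Subsingleton H] (x : X) : x = 0 := by
  have rinner_self : rinner (CompactOp H) x x = 0 :=
    CompactOp.ext_apply fun η => Subsingleton.elim _ _
  rw [← norm_eq_zero, ← sq_eq_zero_iff, norm_sq_eq_norm_rinner (CompactOp H), rinner_self,
    norm_zero]

theorem norm_toLocalization_vectorState_le {ζ : H} (hζ : ‖ζ‖ = 1) (x : X) :
    ‖toLocalization (vectorState ζ hζ) x‖ ≤ ‖x‖ :=
  (isVectorLocalization_toLocalizationₗ hζ).norm_map_le x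

theorem OperatorModel.norm_toOp_apply_eq {K : Type*} [NormedAddCommGroup K] [InnerProductSpace ℂ K]
    (M : OperatorModel H X K) {η : H} (hη : ‖η‖ = 1) (x : X) :
    ‖M.toOp x η‖ = ‖toLocalization (vectorState η hη) x‖ := by
  rw [← sq_eq_sq₀ (norm_nonneg _) (norm_nonneg _), ← inner_self_eq_norm_sq (𝕜 := ℂ),
    ← inner_self_eq_norm_sq (𝕜 := ℂ), M.inner_toOp, inner_toLocalization, vectorState_toFunctional,
    vectorFunctional_apply]

variable (H) in
theorem norm_le_of_forall_toLocalization [Nontrivial H] [CompleteSpace X] {x : X} {c : ℝ}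
    (h : ∀ (ζ : H) (hζ : ‖ζ‖ = 1), ‖toLocalization (vectorState ζ hζ) x‖ ≤ c) : ‖x‖ ≤ c := by
  obtain ⟨ζ, hζ⟩ := exists_norm_eq H zero_le_one
  have M := (isVectorLocalization_toLocalizationₗ (X := X) hζ).operatorModel
  refine M.norm_le_of_forall_toOp ((norm_nonneg _).trans (h ζ hζ)) fun η hη => ?_
  rw [M.norm_toOp_apply_eq hη]
  exact h η hη

theorem hilbertMultiNorm_toLocalization_le (τ : PureState (CompactOp H)) (x : Fin n → X) :
    hilbertMultiNorm ℂ (fun i => toLocalization τ (x i)) ≤ pureStateMultiNorm (CompactOp H) x := by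
  refine le_csSup ⟨∑ i, ‖x i‖, ?_⟩ ⟨τ, rfl⟩
  rintro _ ⟨τ, rfl⟩
  obtain ⟨ζ, hζ, rfl⟩ := exists_eq_vectorState τ
  exact (hilbertMultiNorm_le_sum_norm _).trans
    (Finset.sum_le_sum fun i _ => norm_toLocalization_vectorState_le hζ (x i))

theorem pureStateMultiNorm_nonneg (x : Fin n → X) : 0 ≤ pureStateMultiNorm (CompactOp H) x := by
  refine Real.sSup_nonneg ?_
  rintro _ ⟨τ, rfl⟩
  exact hilbertMultiNorm_nonneg _

theorem pureStateMultiNorm_le_hilbertMultiNorm [CompleteSpace X] (x : Fin n → X) :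
    pureStateMultiNorm (CompactOp H) x ≤ hilbertMultiNorm (CompactOp H)ᵐᵒᵖ x := by
  refine Real.sSup_le ?_ (hilbertMultiNorm_nonneg x)
  rintro _ ⟨τ, rfl⟩
  obtain ⟨ζ, hζ, rfl⟩ := exists_eq_vectorState τ
  have hL := isVectorLocalization_toLocalizationₗ (X := X) hζ
  have le := hL.operatorModel.hilbertMultiNorm_toOp_le hζ x
  simp only [hL.operatorModel_toOp_apply_self] at le
  exact le

theorem norm_sum_le_pureStateMultiNorm [Nontrivial H] [CompleteSpace X] {P : Fin n → X → X}
    (hP : IsProjectionDecomposition (CompactOp H)ᵐᵒᵖ P) (x : Fin n → X) :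
    ‖∑ i, P i (x i)‖ ≤ pureStateMultiNorm (CompactOp H) x := by
  refine norm_le_of_forall_toLocalization H fun ζ hζ => ?_
  have hL := isVectorLocalization_toLocalizationₗ (X := X) hζ
  have le := hL.operatorModel.norm_toOp_sum_apply_le hζ hP x ζ
  simp only [hL.operatorModel_toOp_apply_self] at le
  exact le.trans (hilbertMultiNorm_toLocalization_le _ x)

theorem hilbertMultiNorm_eq_pureStateMultiNorm [CompleteSpace X] (x : Fin n → X) :
    hilbertMultiNorm (CompactOp H)ᵐᵒᵖ x = pureStateMultiNorm (CompactOp H) x := by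
  refine le_antisymm ?_ (pureStateMultiNorm_le_hilbertMultiNorm x)
  refine hilbertMultiNorm_le (pureStateMultiNorm_nonneg x) fun P hP => ?_
  rcases subsingleton_or_nontrivial H with _ | _
  · rw [eq_zero_of_subsingleton H (∑ i, P i (x i)), norm_zero]
    exact pureStateMultiNorm_nonneg x
  · exact norm_sum_le_pureStateMultiNorm hP x

end Transfer

/-! ### Contractions and orthonormal families in inner product spaces -/

section Orthonormal

variable {𝕜 : Type*} [RCLike 𝕜] {E F : Type*} [NormedAddCommGroup E] [InnerProductSpace 𝕜 E]
  [NormedAddCommGroup F] [InnerProductSpace 𝕜 F] {ι : Type*} [Fintype ι]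

theorem exists_orthonormal_eq_norm_smul_of_finiteDimensional [FiniteDimensional 𝕜 F]
    (hι : Fintype.card ι ≤ Module.finrank 𝕜 F) {v : ι → F}
    (hv : Pairwise fun a b => inner 𝕜 (v a) (v b) = 0) :
    ∃ u : ι → F, Orthonormal 𝕜 u ∧ ∀ a, v a = (‖v a‖ : 𝕜) • u a := by
  let w : ι ⊕ Fin (Module.finrank 𝕜 F - Fintype.card ι) → F :=
    Sum.elim (fun a => (‖v a‖⁻¹ : 𝕜) • v a) 0
  have orthonormal_w : Orthonormal 𝕜 (Set.domRestrict {j | w j ≠ 0} w) := by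
    refine ⟨?_, ?_⟩
    · rintro ⟨a | b, hj⟩
      · exact norm_smul_inv_norm fun h => hj (by simp [w, h])
      · exact absurd rfl hj
    · rintro ⟨a | b, hj⟩ ⟨a' | b', hj'⟩ hne
      · have : a ≠ a' := by rintro rfl; exact hne rfl
        simp [w, Set.domRestrict, inner_smul_left, inner_smul_right, hv this]
      all_goals simp [w, Set.domRestrict]
  obtain ⟨b, hb⟩ := orthonormal_w.exists_orthonormalBasis_extension_of_card_eq (by simp; omega)
  refine ⟨b ∘ Sum.inl, b.orthonormal.comp _ Sum.inl_injective, fun a => ?_⟩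
  rcases eq_or_ne (v a) 0 with h0 | h0
  · simp [h0]
  · have norm_ne_zero : (‖v a‖ : 𝕜) ≠ 0 := by simpa using h0
    have b_eq : b (Sum.inl a) = (‖v a‖⁻¹ : 𝕜) • v a :=
      hb (Sum.inl a) (smul_ne_zero (inv_ne_zero norm_ne_zero) h0)
    rw [Function.comp_apply, b_eq, smul_inv_smul₀ norm_ne_zero]

theorem exists_orthonormal_eq_norm_smul (hι : (Fintype.card ι : Cardinal) ≤ Module.rank 𝕜 F)
    {v : ι → F} (hv : Pairwise fun a b => inner 𝕜 (v a) (v b) = 0) :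
    ∃ u : ι → F, Orthonormal 𝕜 u ∧ ∀ a, v a = (‖v a‖ : 𝕜) • u a := by
  obtain ⟨w, hw⟩ := Module.le_rank_iff.1 hι
  let G : Submodule 𝕜 F := Submodule.span 𝕜 (Set.range w ∪ Set.range v)
  have : FiniteDimensional 𝕜 G :=
    FiniteDimensional.span_of_finite 𝕜 ((Set.finite_range w).union (Set.finite_range v))
  have w_mem (a) : w a ∈ G := Submodule.subset_span (Or.inl ⟨a, rfl⟩)
  have v_mem (a) : v a ∈ G := Submodule.subset_span (Or.inr ⟨a, rfl⟩)
  have card_le : Fintype.card ι ≤ Module.finrank 𝕜 G := by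
    have : LinearIndependent 𝕜 fun a => (⟨w a, w_mem a⟩ : G) :=
      LinearIndependent.of_comp G.subtype hw
    simpa using this.fintype_card_le_finrank
  obtain ⟨u, hu, hvu⟩ := exists_orthonormal_eq_norm_smul_of_finiteDimensional card_le
    (v := fun a => ⟨v a, v_mem a⟩) hv
  exact ⟨fun a => u a, hu.comp_linearIsometry G.subtypeₗᵢ, fun a => congrArg Subtype.val (hvu a)⟩

theorem exists_orthonormalBasis_map_orthogonal [FiniteDimensional 𝕜 E] (T : E →ₗ[𝕜] F) :
    ∃ e : OrthonormalBasis (Fin (Module.finrank 𝕜 E)) 𝕜 E,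
      Pairwise fun a b => inner 𝕜 (T (e a)) (T (e b)) = 0 := by
  have isSymmetric := T.rangeRestrict.isSymmetric_adjoint_comp_self
  refine ⟨isSymmetric.eigenvectorBasis rfl, fun a b hab => ?_⟩
  change inner 𝕜 (T.rangeRestrict _) (T.rangeRestrict _) = 0
  rw [← LinearMap.adjoint_inner_right, ← LinearMap.comp_apply, isSymmetric.apply_eigenvectorBasis,
    inner_smul_right, (isSymmetric.eigenvectorBasis rfl).orthonormal.inner_eq_zero hab, mul_zero]

end Orthonormal

section Contraction

variable {E K : Type*} [NormedAddCommGroup E] [InnerProductSpace ℂ E]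
  [NormedAddCommGroup K] [InnerProductSpace ℂ K]

theorem exists_norm_eq_one_and_ofReal_eq {s : ℝ} (hs : |s| ≤ 1) :
    ∃ z : ℂ, ‖z‖ = 1 ∧ (s : ℂ) = 2⁻¹ * (z + star z) := by
  refine ⟨⟨s, √(1 - s ^ 2)⟩, ?_, ?_⟩
  · have : 0 ≤ 1 - s ^ 2 := by rw [sub_nonneg, sq_le_one_iff_abs_le_one]; exact hs
    rw [Complex.norm_eq_sqrt_sq_add_sq, Real.sq_sqrt this, add_sub_cancel, Real.sqrt_one]
  · rw [Complex.star_def, Complex.add_conj, Complex.ofReal_mul]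
    simp

theorem orthonormal_smul {ι : Type*} {z : ι → ℂ} (hz : ∀ i, ‖z i‖ = 1) {u : ι → K}
    (hu : Orthonormal ℂ u) : Orthonormal ℂ fun i => z i • u i :=
  ⟨fun i => by rw [norm_smul, hz, hu.norm_eq_one, mul_one], fun i j hij => by
    change inner ℂ (z i • u i) (z j • u j) = 0
    rw [inner_smul_left, inner_smul_right, hu.inner_eq_zero hij, mul_zero, mul_zero]⟩

theorem exists_linearIsometry_add_of_norm_le [FiniteDimensional ℂ E]
    (hE : (Module.finrank ℂ E : Cardinal) ≤ Module.rank ℂ K) {T : E →ₗ[ℂ] K}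
    (hT : ∀ x, ‖T x‖ ≤ ‖x‖) : ∃ V W : E →ₗᵢ[ℂ] K, ∀ x, T x = (2⁻¹ : ℂ) • (V x + W x) := by
  obtain ⟨e, he⟩ := exists_orthonormalBasis_map_orthogonal T
  obtain ⟨u, hu, hTu⟩ := exists_orthonormal_eq_norm_smul (by simpa using hE) he
  have abs_norm_le (a) : |‖T (e a)‖| ≤ 1 := by
    rw [abs_norm]
    exact (hT _).trans (e.norm_eq_one a).le
  choose z hz norm_eq using fun a => exists_norm_eq_one_and_ofReal_eq (abs_norm_le a)
  have exists_isometry {c : Fin (Module.finrank ℂ E) → ℂ} (hc : ∀ a, ‖c a‖ = 1) :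
      ∃ V : E →ₗᵢ[ℂ] K, ∀ a, V (e a) = c a • u a := by
    have constr_apply (a) : e.toBasis.constr ℂ (fun a => c a • u a) (e a) = c a • u a := by
      rw [← e.coe_toBasis, e.toBasis.constr_basis]
    refine ⟨(e.toBasis.constr ℂ fun a => c a • u a).isometryOfOrthonormal
      (v := e.toBasis) (by simp) ?_, constr_apply⟩
    rw [e.coe_toBasis]
    simpa [Function.comp_def, constr_apply] using orthonormal_smul hc hu
  obtain ⟨V, hV⟩ := exists_isometry hz
  obtain ⟨W, hW⟩ := exists_isometry (c := fun a => star (z a)) fun a => (norm_star _).trans (hz a)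
  refine ⟨V, W, fun x => LinearMap.congr_fun (f := T)
    (g := (2⁻¹ : ℂ) • (V.toLinearMap + W.toLinearMap)) (e.toBasis.ext fun a => ?_) x⟩
  change T (e.toBasis a) = (2⁻¹ : ℂ) • (V (e.toBasis a) + W (e.toBasis a))
  rw [e.coe_toBasis, hV, hW, ← add_smul, smul_smul, ← norm_eq]
  exact hTu a

end Contraction

section Bessel

variable {K : Type*} [NormedAddCommGroup K] [InnerProductSpace ℂ K] {ι : Type*} [Fintype ι]

/-- A finite Bessel family with bound `1`: the synthesis operator `c ↦ ∑ i, c i • k i` from `ℂⁿ` is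
a contraction, expressed through its adjoint. -/
def IsBesselFamily (k : ι → K) : Prop :=
  ∀ g, ∑ i, ‖(inner ℂ (k i) g : ℂ)‖ ^ 2 ≤ ‖g‖ ^ 2

theorem IsBesselFamily.norm_sum_smul_le {k : ι → K} (hk : IsBesselFamily k)
    (c : EuclideanSpace ℂ ι) : ‖∑ i, c i • k i‖ ≤ ‖c‖ := by
  set g := ∑ i, c i • k i
  have norm_sq_le : ‖g‖ * ‖g‖ ≤ ‖c‖ * ‖g‖ :=
    calc ‖g‖ * ‖g‖ = ‖∑ i, star (c i) * inner ℂ (k i) g‖ := by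
          rw [← inner_self_eq_norm_mul_norm (𝕜 := ℂ), inner_self_re_eq_norm]
          simp only [g, sum_inner, inner_smul_left, Complex.star_def]
      _ ≤ ∑ i, ‖c i‖ * ‖(inner ℂ (k i) g : ℂ)‖ :=
          (norm_sum_le _ _).trans_eq (by simp only [norm_mul, norm_star])
      _ ≤ √(∑ i, ‖c i‖ ^ 2) * √(∑ i, ‖(inner ℂ (k i) g : ℂ)‖ ^ 2) :=
          Real.sum_mul_le_sqrt_mul_sqrt _ _ _
      _ ≤ ‖c‖ * ‖g‖ := by
          rw [← EuclideanSpace.norm_eq]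
          gcongr
          exact Real.sqrt_le_iff.2 ⟨norm_nonneg g, hk g⟩
  rcases (norm_nonneg g).eq_or_lt with h0 | h0
  · exact h0 ▸ norm_nonneg c
  · exact le_of_mul_le_mul_right norm_sq_le h0

theorem IsBesselFamily.exists_orthonormal_add
    (hι : (Fintype.card ι : Cardinal) ≤ Module.rank ℂ K) {k : ι → K} (hk : IsBesselFamily k) :
    ∃ u w : ι → K, Orthonormal ℂ u ∧ Orthonormal ℂ w ∧ ∀ i, k i = (2⁻¹ : ℂ) • (u i + w i) := by
  classical
  let b := EuclideanSpace.basisFun ι ℂ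
  have synthesis_le (c) : ‖b.toBasis.constr ℂ k c‖ ≤ ‖c‖ := by
    simpa [b, Module.Basis.constr_apply_fintype] using hk.norm_sum_smul_le c
  obtain ⟨V, W, hVW⟩ := exists_linearIsometry_add_of_norm_le (by simpa using hι) synthesis_le
  refine ⟨V ∘ b, W ∘ b, b.orthonormal.comp_linearIsometry V, b.orthonormal.comp_linearIsometry W,
    fun i => ?_⟩
  rw [Function.comp_apply, Function.comp_apply, ← hVW, ← b.coe_toBasis, b.toBasis.constr_basis]

end Bessel

/-! ### Projection decompositions and Bessel families -/

section Complement

variable {A X : Type*} [NonUnitalCStarAlgebra A] [PartialOrder A]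
  [NormedAddCommGroup X] [NormedSpace ℂ X] [SMul A X] [CStarModule A X]

theorem IsProjection.add {P Q : X → X} (hP : IsProjection A P) (hQ : IsProjection A Q)
    (hPQ : ∀ x, P (Q x) = 0) (hQP : ∀ x, Q (P x) = 0) : IsProjection A fun x => P x + Q x where
  self_adjoint x y := by
    rw [CStarModule.inner_add_left, CStarModule.inner_add_right, hP.self_adjoint, hQ.self_adjoint]
  idempotent x := by
    rw [hP.map_add, hQ.map_add, hP.idempotent, hQ.idempotent, hPQ, hQP, add_zero, zero_add]

theorem IsProjection.one_sub {P : X → X} (hP : IsProjection A P) :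
    IsProjection A fun x => x - P x where
  self_adjoint x y := by
    rw [CStarModule.inner_sub_left, CStarModule.inner_sub_right, hP.self_adjoint]
  idempotent x := by
    have map_sub : P (x - P x) = 0 :=
      add_right_cancel (b := P (P x)) <| by
        rw [← hP.map_add, sub_add_cancel, hP.idempotent, zero_add]
    rw [map_sub, sub_zero]

theorem IsProjection.map_finsetSum {ι : Type*} {P : X → X} (hP : IsProjection A P) (s : Finset ι)
    (x : ι → X) : P (∑ i ∈ s, x i) = ∑ i ∈ s, P (x i) :=
  map_sum (AddMonoidHom.mk' P hP.map_add) x s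

section Orthogonal

variable {ι : Type*} [Fintype ι] {P : ι → X → X} (hP : ∀ i, IsProjection A (P i))
  (orthogonal : ∀ i j, i ≠ j → ∀ x, P i (P j x) = 0)

include hP orthogonal

theorem apply_sum_of_orthogonal (i : ι) (x : X) : P i (∑ j, P j x) = P i x := by
  rw [(hP i).map_finsetSum, Finset.sum_eq_single_of_mem i (Finset.mem_univ i), (hP i).idempotent]
  exact fun j _ hj => orthogonal i j hj.symm x

theorem sum_apply_of_orthogonal (i : ι) (x : X) : ∑ j, P j (P i x) = P i x := by
  rw [Finset.sum_eq_single_of_mem i (Finset.mem_univ i), (hP i).idempotent]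
  exact fun j _ hj => orthogonal j i hj x

theorem isProjection_sum_of_orthogonal : IsProjection A fun x => ∑ i, P i x where
  self_adjoint x y := by
    rw [CStarModule.inner_sum_left, CStarModule.inner_sum_right]
    exact Finset.sum_congr rfl fun i _ => (hP i).self_adjoint x y
  idempotent x :=
    Finset.sum_congr rfl fun i _ => apply_sum_of_orthogonal hP orthogonal i x

end Orthogonal

theorem exists_isProjectionDecomposition_of_orthogonal {n : ℕ} [NeZero n] {P : Fin n → X → X}
    (hP : ∀ i, IsProjection A (P i)) (orthogonal : ∀ i j, i ≠ j → ∀ x, P i (P j x) = 0) :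
    ∃ Q : Fin n → X → X, IsProjectionDecomposition A Q ∧ ∀ i x, Q i (P i x) = P i x := by
  let R (x : X) : X := x - ∑ i, P i x
  have hR : IsProjection A R := (isProjection_sum_of_orthogonal hP orthogonal).one_sub
  have R_apply (i x) : R (P i x) = 0 :=
    sub_eq_zero.2 (sum_apply_of_orthogonal hP orthogonal i x).symm
  have apply_R (i x) : P i (R x) = 0 :=
    add_right_cancel (b := P i (∑ j, P j x)) <| by
      rw [← (hP i).map_add, sub_add_cancel, apply_sum_of_orthogonal hP orthogonal, zero_add]
  let Q (i : Fin n) (x : X) : X := P i x + if i = 0 then R x else 0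
  have Q_zero : Q 0 = fun x => P 0 x + R x := by simp [Q]
  have Q_of_ne {i : Fin n} (hi : i ≠ 0) : Q i = P i := by simp [Q, hi]
  have isProjection_Q (i) : IsProjection A (Q i) := by
    rcases eq_or_ne i 0 with rfl | hi
    · exact Q_zero ▸ (hP 0).add hR (apply_R 0) (R_apply 0)
    · exact Q_of_ne hi ▸ hP i
  refine ⟨Q, ⟨isProjection_Q, fun i j hij x => ?_, fun x => ?_⟩, fun i x => ?_⟩
  · rcases eq_or_ne i 0 with rfl | hi
    · simp [Q_zero, Q_of_ne hij.symm, orthogonal 0 j hij, R_apply]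
    rcases eq_or_ne j 0 with rfl | hj
    · simp [Q_zero, Q_of_ne hi, (hP i).map_add, orthogonal i 0 hij, apply_R]
    · simp [Q_of_ne hi, Q_of_ne hj, orthogonal i j hij]
  · simp [Q, Finset.sum_add_distrib, R]
  · simp [Q, (hP i).idempotent, R_apply]

end Complement

section Bessel

variable {K : Type*} [NormedAddCommGroup K] [InnerProductSpace ℂ K] {n : ℕ}

theorem IsProjectionDecomposition.norm_sum_sq {Q : Fin n → K → K}
    (hQ : IsProjectionDecomposition ℂ Q) (k : Fin n → K) :
    ‖∑ i, Q i (k i)‖ ^ 2 = ∑ i, ‖Q i (k i)‖ ^ 2 := by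
  have inner_eq_zero (i j) (hij : i ≠ j) : inner ℂ (Q i (k i)) (Q j (k j)) = 0 :=
    ((hQ.isProjection i).self_adjoint _ _).trans (by
      rw [hQ.orthogonal i j hij]; exact inner_zero_right (𝕜 := ℂ) (k i))
  simp only [← inner_self_eq_norm_sq (𝕜 := ℂ), sum_inner, inner_sum, map_sum]
  exact Finset.sum_congr rfl fun i _ => Finset.sum_eq_single_of_mem i (Finset.mem_univ i)
    fun j _ hji => by rw [inner_eq_zero j i hji, map_zero]

theorem isProjection_rankOne {u : K} (hu : ‖u‖ = 1) :
    IsProjection ℂ fun k => (inner ℂ u k : ℂ) • u where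
  self_adjoint x y := by
    change inner ℂ (inner ℂ u x • u) y = inner ℂ x (inner ℂ u y • u)
    rw [inner_smul_left, inner_smul_right, inner_conj_symm, mul_comm]
  idempotent x := by simp [hu]

theorem exists_decomposition_of_orthonormal [NeZero n] {u : Fin n → K} (hu : Orthonormal ℂ u) :
    ∃ Q : Fin n → K → K, IsProjectionDecomposition ℂ Q ∧ ∀ i, Q i (u i) = u i := by
  obtain ⟨Q, hQ, hQu⟩ := exists_isProjectionDecomposition_of_orthogonal
    (fun i => isProjection_rankOne (hu.norm_eq_one i))
    fun i j hij x => by simp [hu.inner_eq_zero hij]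
  exact ⟨Q, hQ, fun i => by simpa [hu.norm_eq_one] using hQu i (u i)⟩

theorem IsProjection.norm_inner_le {Q : K → K} (hQ : IsProjection ℂ Q) {k : K} (hk : ‖k‖ ≤ 1)
    (hQk : Q k = k) (g : K) : ‖(inner ℂ k g : ℂ)‖ ≤ ‖Q g‖ :=
  calc ‖(inner ℂ k g : ℂ)‖ = ‖(inner ℂ k (Q g) : ℂ)‖ := by
        conv_lhs => rw [← hQk]
        exact congrArg _ (hQ.self_adjoint k g)
    _ ≤ ‖k‖ * ‖Q g‖ := norm_inner_le_norm _ _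
    _ ≤ ‖Q g‖ := mul_le_of_le_one_left (norm_nonneg _) hk

theorem IsProjectionDecomposition.isBesselFamily {Q : Fin n → K → K}
    (hQ : IsProjectionDecomposition ℂ Q) {k : Fin n → K} (hk : ∀ i, ‖k i‖ ≤ 1)
    (hQk : ∀ i, Q i (k i) = k i) : IsBesselFamily k := fun g =>
  calc ∑ i, ‖(inner ℂ (k i) g : ℂ)‖ ^ 2 ≤ ∑ i, ‖Q i g‖ ^ 2 := by
        gcongr with i
        exact (hQ.isProjection i).norm_inner_le (hk i) (hQk i) g
    _ = ‖g‖ ^ 2 := by rw [← hQ.norm_sum_sq fun _ => g, hQ.sum_eq]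

theorem exists_norm_smul_le_one_norm_inner_eq (v : K) :
    ∃ c : ℂ, ‖c • v‖ ≤ 1 ∧ ‖(inner ℂ (c • v) v : ℂ)‖ = ‖v‖ := by
  rcases eq_or_ne v 0 with rfl | hv
  · exact ⟨0, by simp⟩
  · have : ‖v‖ ≠ 0 := norm_ne_zero_iff.2 hv
    refine ⟨(‖v‖⁻¹ : ℂ), by simp [norm_smul, this], ?_⟩
    rw [inner_smul_left, norm_mul, ← inner_self_re_eq_norm, inner_self_eq_norm_mul_norm]
    simp [this]

theorem IsProjectionDecomposition.exists_isBesselFamily {Q : Fin n → K → K}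
    (hQ : IsProjectionDecomposition ℂ Q) (h : Fin n → K) :
    ∃ k : Fin n → K, IsBesselFamily k ∧
      ‖∑ i, Q i (h i)‖ ^ 2 = ∑ i, ‖(inner ℂ (k i) (h i) : ℂ)‖ ^ 2 := by
  choose c hc norm_inner_eq using fun i => exists_norm_smul_le_one_norm_inner_eq (Q i (h i))
  have Q_apply (i) : Q i (c i • Q i (h i)) = c i • Q i (h i) := by
    rw [(hQ.isProjection i).map_smul, (hQ.isProjection i).idempotent]
  refine ⟨fun i => c i • Q i (h i), hQ.isBesselFamily hc Q_apply, ?_⟩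
  rw [hQ.norm_sum_sq]
  refine Finset.sum_congr rfl fun i _ => ?_
  rw [← norm_inner_eq]
  change _ = ‖(inner ℂ (c i • Q i (h i)) (h i) : ℂ)‖ ^ 2
  conv_rhs => rw [← Q_apply]
  exact congrArg (‖·‖ ^ 2) ((hQ.isProjection i).self_adjoint _ _).symm

theorem sum_norm_inner_sq_le_of_orthonormal {u : Fin n → K} (hu : Orthonormal ℂ u)
    (h : Fin n → K) : ∑ i, ‖(inner ℂ (u i) (h i) : ℂ)‖ ^ 2 ≤ hilbertMultiNorm ℂ h ^ 2 := by
  rcases n.eq_zero_or_pos with rfl | hn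
  · simpa using sq_nonneg _
  have : NeZero n := ⟨hn.ne'⟩
  obtain ⟨Q, hQ, hQu⟩ := exists_decomposition_of_orthonormal hu
  calc ∑ i, ‖(inner ℂ (u i) (h i) : ℂ)‖ ^ 2 ≤ ∑ i, ‖Q i (h i)‖ ^ 2 := by
        gcongr with i
        exact (hQ.isProjection i).norm_inner_le (hu.norm_eq_one i).le (hQu i) _
    _ = ‖∑ i, Q i (h i)‖ ^ 2 := (hQ.norm_sum_sq h).symm
    _ ≤ hilbertMultiNorm ℂ h ^ 2 := by gcongr; exact hQ.norm_sum_le_hilbertMultiNorm h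

theorem IsBesselFamily.sum_norm_inner_sq_le (hn : (n : Cardinal) ≤ Module.rank ℂ K)
    {k : Fin n → K} (hk : IsBesselFamily k) (h : Fin n → K) :
    ∑ i, ‖(inner ℂ (k i) (h i) : ℂ)‖ ^ 2 ≤ hilbertMultiNorm ℂ h ^ 2 := by
  obtain ⟨u, w, hu, hw, hkuw⟩ := hk.exists_orthonormal_add (by simpa using hn)
  have norm_inner_sq_le (i) : ‖(inner ℂ (k i) (h i) : ℂ)‖ ^ 2 ≤
      2⁻¹ * (‖(inner ℂ (u i) (h i) : ℂ)‖ ^ 2 + ‖(inner ℂ (w i) (h i) : ℂ)‖ ^ 2) := by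
    rw [hkuw, inner_smul_left, inner_add_left, norm_mul]
    have triangle := norm_add_le (inner ℂ (u i) (h i) : ℂ) (inner ℂ (w i) (h i))
    rw [RCLike.norm_conj, norm_inv, Complex.norm_ofNat]
    nlinarith [norm_nonneg ((inner ℂ (u i) (h i) : ℂ) + inner ℂ (w i) (h i)),
      sq_nonneg (‖(inner ℂ (u i) (h i) : ℂ)‖ - ‖(inner ℂ (w i) (h i) : ℂ)‖)]
  calc ∑ i, ‖(inner ℂ (k i) (h i) : ℂ)‖ ^ 2
      ≤ 2⁻¹ * (∑ i, ‖(inner ℂ (u i) (h i) : ℂ)‖ ^ 2 +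
          ∑ i, ‖(inner ℂ (w i) (h i) : ℂ)‖ ^ 2) := by
        rw [← Finset.sum_add_distrib, Finset.mul_sum]
        exact Finset.sum_le_sum fun i _ => norm_inner_sq_le i
    _ ≤ 2⁻¹ * (hilbertMultiNorm ℂ h ^ 2 + hilbertMultiNorm ℂ h ^ 2) := by
        gcongr
        · exact sum_norm_inner_sq_le_of_orthonormal hu h
        · exact sum_norm_inner_sq_le_of_orthonormal hw h
    _ = hilbertMultiNorm ℂ h ^ 2 := by ring

end Bessel

/-! ### The dual multi-norm -/

section DualNorm

variable {A X : Type*} [NonUnitalCStarAlgebra A] [PartialOrder A]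
  [NormedAddCommGroup X] [NormedSpace ℂ X] [SMul Aᵐᵒᵖ X] [CStarModule Aᵐᵒᵖ X] {n : ℕ}

variable (A) in
theorem starMultiNorm_nonneg (x : Fin n → X) : 0 ≤ starMultiNorm A x :=
  Real.sSup_nonneg <| by rintro _ ⟨y, -, rfl⟩; exact Real.sqrt_nonneg _

theorem starMultiNorm_le {x : Fin n → X} {c : ℝ} (hc : 0 ≤ c)
    (h : ∀ y : Fin n → X, muStar A y ≤ 1 →
      √‖∑ i, star (rinner A (y i) (x i)) * rinner A (y i) (x i)‖ ≤ c) :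
    starMultiNorm A x ≤ c :=
  Real.sSup_le (by rintro _ ⟨y, hy, rfl⟩; exact h y hy) hc

theorem le_starMultiNorm {x : Fin n → X} {c : ℝ}
    (h : ∀ y : Fin n → X, muStar A y ≤ 1 →
      √‖∑ i, star (rinner A (y i) (x i)) * rinner A (y i) (x i)‖ ≤ c)
    {y : Fin n → X} (hy : muStar A y ≤ 1) :
    √‖∑ i, star (rinner A (y i) (x i)) * rinner A (y i) (x i)‖ ≤ starMultiNorm A x :=
  le_csSup ⟨c, by rintro _ ⟨y, hy, rfl⟩; exact h y hy⟩ ⟨y, hy, rfl⟩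

variable [StarOrderedRing A]

theorem norm_sum_star_rinner_mul_rinner_le (y : Fin n → X) (z : X) :
    ‖∑ i, star (rinner A (y i) z) * rinner A (y i) z‖ ≤ ∑ i, (‖y i‖ * ‖z‖) ^ 2 :=
  norm_sum_le_of_le _ fun i _ => by
    rw [CStarRing.norm_star_mul_self, ← sq]
    gcongr
    exact norm_rinner_le (y i) z

theorem sqrt_norm_sum_le_muStar (y : Fin n → X) {z : X} (hz : ‖z‖ ≤ 1) :
    √‖∑ i, star (rinner A (y i) z) * rinner A (y i) z‖ ≤ muStar A y := by
  refine le_csSup ⟨√(∑ i, ‖y i‖ ^ 2), ?_⟩ ⟨z, hz, rfl⟩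
  rintro _ ⟨z, hz, rfl⟩
  refine Real.sqrt_le_sqrt ((norm_sum_star_rinner_mul_rinner_le y z).trans ?_)
  gcongr with i
  exact mul_le_of_le_one_right (norm_nonneg _) hz

theorem norm_sum_le_of_muStar_le_one {y : Fin n → X} (hy : muStar A y ≤ 1) (z : X) :
    ‖∑ i, star (rinner A (y i) z) * rinner A (y i) z‖ ≤ ‖z‖ ^ 2 := by
  rcases eq_or_ne z 0 with rfl | hz
  · simpa using norm_sum_star_rinner_mul_rinner_le (A := A) y 0
  have norm_ne_zero : ‖z‖ ≠ 0 := norm_ne_zero_iff.2 hz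
  have unit_le := (sqrt_norm_sum_le_muStar (A := A) y
    (z := (‖z‖⁻¹ : ℂ) • z) (by simp [norm_smul, norm_ne_zero])).trans hy
  simp only [Real.sqrt_le_one, rinner_smul_right, star_smul, smul_mul_smul_comm,
    ← Finset.smul_sum, norm_smul, norm_mul, norm_star, norm_inv, Complex.norm_real,
    norm_norm] at unit_le
  rwa [← mul_inv, ← sq, inv_mul_le_iff₀ (by positivity), mul_one] at unit_le

end DualNorm

section SumStarMul

variable {H : Type*} [NormedAddCommGroup H] [InnerProductSpace ℂ H] [CompleteSpace H] {n : ℕ}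

theorem inner_sum_star_mul_apply (b : Fin n → CompactOp H) (η : H) :
    inner ℂ η (((∑ i, star (b i) * b i : CompactOp H) : H →L[ℂ] H) η) =
      (∑ i, ‖(b i : H →L[ℂ] H) η‖ ^ 2 : ℝ) := by
  rw [AddSubmonoidClass.coe_finsetSum, sum_apply, inner_sum, Complex.ofReal_sum]
  refine Finset.sum_congr rfl fun i _ => ?_
  exact (ContinuousLinearMap.adjoint_inner_right (b i : H →L[ℂ] H) _ _).trans
    ((inner_self_eq_norm_sq_to_K _).trans (by simp))

theorem sum_norm_apply_sq_le (b : Fin n → CompactOp H) {η : H} (hη : ‖η‖ = 1) :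
    ∑ i, ‖(b i : H →L[ℂ] H) η‖ ^ 2 ≤ ‖∑ i, star (b i) * b i‖ := by
  set S : CompactOp H := ∑ i, star (b i) * b i with hS
  calc ∑ i, ‖(b i : H →L[ℂ] H) η‖ ^ 2 ≤ ‖((∑ i, ‖(b i : H →L[ℂ] H) η‖ ^ 2 : ℝ) : ℂ)‖ := by
        rw [Complex.norm_real]
        exact le_abs_self _
    _ = ‖(inner ℂ η ((S : H →L[ℂ] H) η) : ℂ)‖ := by rw [hS, inner_sum_star_mul_apply]
    _ ≤ ‖η‖ * ‖(S : H →L[ℂ] H) η‖ := norm_inner_le_norm _ _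
    _ ≤ ‖η‖ * (‖S‖ * ‖η‖) := by gcongr; exact (S : H →L[ℂ] H).le_opNorm η
    _ = ‖S‖ := by rw [hη, one_mul, mul_one]

theorem norm_sum_star_mul_le (b : Fin n → CompactOp H) {c : ℝ} (hc : 0 ≤ c)
    (h : ∀ η : H, ‖η‖ = 1 → ∑ i, ‖(b i : H →L[ℂ] H) η‖ ^ 2 ≤ c) :
    ‖∑ i, star (b i) * b i‖ ≤ c := by
  set S : CompactOp H := ∑ i, star (b i) * b i with hS
  have isPositive_S : (S : H →L[ℂ] H).IsPositive :=
    CompactOp.nonneg_iff.1 (Finset.sum_nonneg fun i _ => star_mul_self_nonneg (b i))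
  have abs_rayleighQuotient_le (η : H) (hη : ‖η‖ = 1) :
      |(S : H →L[ℂ] H).rayleighQuotient η| ≤ c := by
    rw [ContinuousLinearMap.rayleighQuotient, ContinuousLinearMap.reApplyInnerSelf_apply, hη,
      one_pow, div_one, inner_re_symm, hS, inner_sum_star_mul_apply,
      RCLike.re_eq_complex_re, Complex.ofReal_re]
    exact (abs_of_nonneg (Finset.sum_nonneg fun i _ => sq_nonneg _)).trans_le (h η hη)
  refine (ContinuousLinearMap.norm_eq_iSup_rayleighQuotient _ isPositive_S.isSymmetric).trans_le
    (ciSup_le fun η => ?_)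
  rcases eq_or_ne η 0 with rfl | hη
  · simpa using hc
  · have norm_ne_zero : (‖η‖ : ℂ)⁻¹ ≠ 0 := by simpa using hη
    rw [← ContinuousLinearMap.rayleigh_smul _ η norm_ne_zero]
    exact abs_rayleighQuotient_le _ (by simp [norm_smul, hη])

end SumStarMul

section BesselModel

variable {H : Type*} [NormedAddCommGroup H] [InnerProductSpace ℂ H] [CompleteSpace H]
  {X : Type*} [NormedAddCommGroup X] [NormedSpace ℂ X]
  [SMul (CompactOp H)ᵐᵒᵖ X] [CStarModule (CompactOp H)ᵐᵒᵖ X]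

namespace OperatorModel

variable {K : Type*} [NormedAddCommGroup K] [InnerProductSpace ℂ K] (M : OperatorModel H X K)
  {ζ : H} {n : ℕ}

theorem rinner_apply_of_toOp_eq_rankOne {y : X} {k : K}
    (hy : M.toOp y = InnerProductSpace.rankOne ℂ k ζ) (z : X) (η : H) :
    (rinner (CompactOp H) y z : H →L[ℂ] H) η = (inner ℂ k (M.toOp z η) : ℂ) • ζ :=
  ext_inner_left ℂ fun ξ => by
    rw [← M.inner_toOp, hy, InnerProductSpace.rankOne_apply, inner_smul_left, inner_smul_right,
      inner_conj_symm, mul_comm]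

theorem norm_rinner_apply_of_toOp_eq_rankOne (hζ : ‖ζ‖ = 1) {y : X} {k : K}
    (hy : M.toOp y = InnerProductSpace.rankOne ℂ k ζ) (z : X) (η : H) :
    ‖(rinner (CompactOp H) y z : H →L[ℂ] H) η‖ = ‖(inner ℂ k (M.toOp z η) : ℂ)‖ := by
  rw [M.rinner_apply_of_toOp_eq_rankOne hy, norm_smul, hζ, mul_one]

theorem muStar_le_one_of_isBesselFamily (hζ : ‖ζ‖ = 1) {y : Fin n → X} {k : Fin n → K}
    (hk : IsBesselFamily k) (hy : ∀ i, M.toOp (y i) = InnerProductSpace.rankOne ℂ (k i) ζ) :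
    muStar (CompactOp H) y ≤ 1 := by
  refine Real.sSup_le ?_ zero_le_one
  rintro _ ⟨z, hz, rfl⟩
  refine Real.sqrt_le_one.2 (norm_sum_star_mul_le _ zero_le_one fun η hη => ?_)
  simp only [M.norm_rinner_apply_of_toOp_eq_rankOne hζ (hy _)]
  exact (hk _).trans (pow_le_one₀ (norm_nonneg _) ((M.norm_toOp_apply_le z hη).trans hz))

theorem exists_muStar_le_one_norm_sum_le (hζ : ‖ζ‖ = 1) {Q : Fin n → K → K}
    (hQ : IsProjectionDecomposition ℂ Q) (x : Fin n → X) :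
    ∃ y : Fin n → X, muStar (CompactOp H) y ≤ 1 ∧ ‖∑ i, Q i (M.toOp (x i) ζ)‖ ≤
      √‖∑ i, star (rinner (CompactOp H) (y i) (x i)) * rinner (CompactOp H) (y i) (x i)‖ := by
  obtain ⟨k, hk, norm_sum_sq⟩ := hQ.exists_isBesselFamily fun i => M.toOp (x i) ζ
  choose y hy using fun i => M.exists_toOp_eq_rankOne (k i) ζ
  refine ⟨y, M.muStar_le_one_of_isBesselFamily hζ hk hy, Real.le_sqrt_of_sq_le ?_⟩
  simp only [norm_sum_sq, ← M.norm_rinner_apply_of_toOp_eq_rankOne hζ (hy _)]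
  exact sum_norm_apply_sq_le _ hζ

theorem isBesselFamily_of_muStar_le_one (hζ : ‖ζ‖ = 1) {y : Fin n → X}
    (hy : muStar (CompactOp H) y ≤ 1) {w : Fin n → H} (hw : ∀ i, ‖w i‖ ≤ 1) :
    IsBesselFamily fun i => M.toOp (y i) (w i) := fun g => by
  obtain ⟨z, hz⟩ := M.exists_toOp_eq_rankOne g ζ
  have toOp_z : M.toOp z ζ = g := by simp [hz, hζ]
  have norm_z : ‖z‖ = ‖g‖ := by
    rw [← M.toOp.norm_map, hz, InnerProductSpace.norm_rankOne, hζ, mul_one]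
  calc ∑ i, ‖(inner ℂ (M.toOp (y i) (w i)) g : ℂ)‖ ^ 2
      ≤ ∑ i, ‖(rinner (CompactOp H) (y i) z : H →L[ℂ] H) ζ‖ ^ 2 := by
        gcongr with i
        rw [← toOp_z, M.inner_toOp]
        exact (norm_inner_le_norm _ _).trans (mul_le_of_le_one_left (norm_nonneg _) (hw i))
    _ ≤ ‖z‖ ^ 2 := (sum_norm_apply_sq_le _ hζ).trans (norm_sum_le_of_muStar_le_one hy z)
    _ = ‖g‖ ^ 2 := by rw [norm_z]

theorem sum_norm_rinner_apply_sq_le (hζ : ‖ζ‖ = 1) (hn : (n : Cardinal) ≤ Module.rank ℂ K)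
    {y : Fin n → X} (hy : muStar (CompactOp H) y ≤ 1) (x : Fin n → X) :
    ∑ i, ‖(rinner (CompactOp H) (y i) (x i) : H →L[ℂ] H) ζ‖ ^ 2 ≤
      hilbertMultiNorm ℂ (fun i => M.toOp (x i) ζ) ^ 2 := by
  choose c hc norm_inner_eq using fun i =>
    exists_norm_smul_le_one_norm_inner_eq ((rinner (CompactOp H) (y i) (x i) : H →L[ℂ] H) ζ)
  simp only [← norm_inner_eq, ← M.inner_toOp]
  exact (M.isBesselFamily_of_muStar_le_one hζ hy hc).sum_norm_inner_sq_le hn _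

theorem rinner_eq_smul_rankOneOp {u v : X} {k l : K}
    (hu : M.toOp u = InnerProductSpace.rankOne ℂ k ζ)
    (hv : M.toOp v = InnerProductSpace.rankOne ℂ l ζ) :
    rinner (CompactOp H) u v = (inner ℂ k l : ℂ) • rankOneOp ζ ζ :=
  CompactOp.ext_apply fun η => by
    rw [M.rinner_apply_of_toOp_eq_rankOne hu, hv]
    simp [smul_smul, mul_comm]

end OperatorModel

end BesselModel

section OrthDim

variable {H : Type*} [NormedAddCommGroup H] [InnerProductSpace ℂ H] [CompleteSpace H]
  {X : Type*} [NormedAddCommGroup X] [NormedSpace ℂ X]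
  [SMul (CompactOp H)ᵐᵒᵖ X] [CStarModule (CompactOp H)ᵐᵒᵖ X]

namespace OperatorModel

variable {K : Type*} [NormedAddCommGroup K] [InnerProductSpace ℂ K] (M : OperatorModel H X K)
  {ζ : H}

section Basis

variable {ι : Type*} [Fintype ι] {b : OrthonormalBasis ι ℂ K} {u : ι → X}

theorem op_rankOneOp_smul_eq_sum (hζ : ‖ζ‖ = 1)
    (hu : ∀ a, M.toOp (u a) = InnerProductSpace.rankOne ℂ (b a) ζ) (x : X) (η ξ : H) :
    MulOpposite.op (rankOneOp η ξ) • x =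
      ∑ a, (inner ℂ (b a) (M.toOp x η) : ℂ) • MulOpposite.op (rankOneOp ζ ξ) • u a := by
  refine M.toOp.injective ?_
  simp only [map_sum, map_smul, toOp_rankOneOp_smul, hu]
  conv_lhs => rw [← b.sum_repr' (M.toOp x η)]
  simp [hζ]

theorem isOrthonormalBasis_range (hζ : ‖ζ‖ = 1)
    (hu : ∀ a, M.toOp (u a) = InnerProductSpace.rankOne ℂ (b a) ζ) :
    IsOrthonormalBasis (CompactOp H) X (Set.range u) where
  basic := by
    rintro _ ⟨a, rfl⟩
    rw [M.rinner_eq_smul_rankOneOp (hu a) (hu a), inner_self_eq_norm_sq_to_K, b.norm_eq_one]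
    simpa using isMinimalProjection_rankOneOp hζ
  orthogonal := by
    rintro _ ⟨a, rfl⟩ _ ⟨c, rfl⟩ hac
    rw [M.rinner_eq_smul_rankOneOp (hu a) (hu c),
      b.inner_eq_zero fun h => hac (congrArg u h), zero_smul]
  dense x := Metric.mem_closure_iff.2 fun ε hε => by
    obtain ⟨F, _, hF⟩ := exists_norm_sub_projOp_smul_le (H := H) x (half_pos hε)
    refine ⟨MulOpposite.op (projOp F) • x, ?_, by rw [dist_eq_norm]; linarith⟩
    rw [projOp_eq_sum_rankOneOp, Finset.op_sum, ← algebraSMul_apply, map_sum, LinearMap.sum_apply]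
    refine Submodule.sum_mem _ fun i _ => ?_
    rw [algebraSMul_apply, M.op_rankOneOp_smul_eq_sum hζ hu]
    exact Submodule.sum_mem _ fun a _ => Submodule.smul_mem _ _ <|
      Submodule.subset_span (Or.inr ⟨u a, ⟨a, rfl⟩, _, rfl⟩)

end Basis

include M

theorem orthDim_le_finrank (hζ : ‖ζ‖ = 1) [FiniteDimensional ℂ K] :
    orthDim (CompactOp H) X ≤ Module.finrank ℂ K := by
  choose u hu using fun a => M.exists_toOp_eq_rankOne (stdOrthonormalBasis ℂ K a) ζ
  calc orthDim (CompactOp H) X ≤ Cardinal.mk (Set.range u) :=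
        csInf_le' ⟨_, M.isOrthonormalBasis_range hζ hu, rfl⟩
    _ ≤ Module.finrank ℂ K := by simpa using Cardinal.mk_range_le_lift (f := u)

theorem natCast_le_rank (hζ : ‖ζ‖ = 1) {n : ℕ} (hn : (n : Cardinal) ≤ orthDim (CompactOp H) X) :
    (n : Cardinal) ≤ Module.rank ℂ K := by
  rcases lt_or_ge (Module.rank ℂ K) Cardinal.aleph0 with hK | hK
  · have : FiniteDimensional ℂ K := Module.rank_lt_aleph0_iff.1 hK
    rw [← Module.finrank_eq_rank]
    exact_mod_cast hn.trans (M.orthDim_le_finrank hζ)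
  · exact Cardinal.natCast_lt_aleph0.le.trans hK

end OperatorModel

end OrthDim

section Dual

variable {H : Type*} [NormedAddCommGroup H] [InnerProductSpace ℂ H] [CompleteSpace H]
  {X : Type*} [NormedAddCommGroup X] [NormedSpace ℂ X] [CompleteSpace X]
  [SMul (CompactOp H)ᵐᵒᵖ X] [CStarModule (CompactOp H)ᵐᵒᵖ X] {n : ℕ}

theorem sqrt_norm_sum_le_hilbertMultiNorm (hn : (n : Cardinal) ≤ orthDim (CompactOp H) X)
    {y : Fin n → X} (hy : muStar (CompactOp H) y ≤ 1) (x : Fin n → X) :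
    √‖∑ i, star (rinner (CompactOp H) (y i) (x i)) * rinner (CompactOp H) (y i) (x i)‖ ≤
      hilbertMultiNorm (CompactOp H)ᵐᵒᵖ x := by
  refine Real.sqrt_le_iff.2 ⟨hilbertMultiNorm_nonneg x, ?_⟩
  refine norm_sum_star_mul_le _ (sq_nonneg _) fun ζ hζ => ?_
  let M := (isVectorLocalization_toLocalizationₗ (X := X) hζ).operatorModel
  refine (M.sum_norm_rinner_apply_sq_le hζ (M.natCast_le_rank hζ hn) hy x).trans ?_
  have := hilbertMultiNorm_nonneg (A := ℂ) fun i => M.toOp (x i) ζ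
  gcongr
  exact M.hilbertMultiNorm_toOp_le hζ x

theorem starMultiNorm_le_hilbertMultiNorm (hn : (n : Cardinal) ≤ orthDim (CompactOp H) X)
    (x : Fin n → X) :
    starMultiNorm (CompactOp H) x ≤ hilbertMultiNorm (CompactOp H)ᵐᵒᵖ x :=
  starMultiNorm_le (hilbertMultiNorm_nonneg x) fun _ hy => sqrt_norm_sum_le_hilbertMultiNorm hn hy x

theorem pureStateMultiNorm_le_starMultiNorm (hn : (n : Cardinal) ≤ orthDim (CompactOp H) X)
    (x : Fin n → X) : pureStateMultiNorm (CompactOp H) x ≤ starMultiNorm (CompactOp H) x := by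
  refine Real.sSup_le ?_ (starMultiNorm_nonneg _ x)
  rintro _ ⟨τ, rfl⟩
  obtain ⟨ζ, hζ, rfl⟩ := exists_eq_vectorState τ
  refine hilbertMultiNorm_le (starMultiNorm_nonneg _ x) fun Q hQ => ?_
  have hL := isVectorLocalization_toLocalizationₗ (X := X) hζ
  obtain ⟨y, hy, norm_sum_le⟩ := hL.operatorModel.exists_muStar_le_one_norm_sum_le hζ hQ x
  simp only [hL.operatorModel_toOp_apply_self] at norm_sum_le
  exact norm_sum_le.trans
    (le_starMultiNorm (fun y hy => sqrt_norm_sum_le_hilbertMultiNorm hn hy x) hy)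

theorem hilbertMultiNorm_eq_starMultiNorm (hn : (n : Cardinal) ≤ orthDim (CompactOp H) X)
    (x : Fin n → X) :
    hilbertMultiNorm (CompactOp H)ᵐᵒᵖ x = starMultiNorm (CompactOp H) x :=
  le_antisymm
    ((hilbertMultiNorm_eq_pureStateMultiNorm x).trans_le (pureStateMultiNorm_le_starMultiNorm hn x))
    (starMultiNorm_le_hilbertMultiNorm hn x)

end Dual

section Degenerate

variable {H : Type*} [NormedAddCommGroup H] [InnerProductSpace ℂ H] [CompleteSpace H]

theorem hilbertMultiNorm_eq_starMultiNorm_of_subsingleton [Subsingleton H]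
    {X : Type*} [NormedAddCommGroup X] [NormedSpace ℂ X]
    [SMul (CompactOp H)ᵐᵒᵖ X] [CStarModule (CompactOp H)ᵐᵒᵖ X] {n : ℕ} (x : Fin n → X) :
    hilbertMultiNorm (CompactOp H)ᵐᵒᵖ x = starMultiNorm (CompactOp H) x := by
  refine le_antisymm (hilbertMultiNorm_le (starMultiNorm_nonneg _ x) fun P _ => ?_)
    (starMultiNorm_le (hilbertMultiNorm_nonneg x) fun y _ => ?_)
  · rw [eq_zero_of_subsingleton H (∑ i, P i (x i)), norm_zero]
    exact starMultiNorm_nonneg _ x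
  · rw [CompactOp.ext_apply (a := ∑ i, _) (b := 0) fun η => Subsingleton.elim _ _, norm_zero,
      Real.sqrt_zero]
    exact hilbertMultiNorm_nonneg x

theorem one_le_hilbertDim [Nontrivial H] : 1 ≤ hilbertDim H := by
  refine le_csInf ?_ ?_
  · obtain ⟨w, b, hb⟩ := exists_hilbertBasis ℂ H
    refine ⟨_, w, hb ▸ b.orthonormal, ?_, rfl⟩
    have := b.dense_span
    rw [hb, Subtype.range_coe] at this
    exact Submodule.dense_iff_topologicalClosure_eq_top.2 this
  · rintro _ ⟨S, -, hS, rfl⟩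
    rw [Cardinal.one_le_iff_ne_zero, Cardinal.mk_ne_zero_iff, Set.nonempty_coe_sort,
      Set.nonempty_iff_ne_empty]
    rintro rfl
    obtain ⟨η, hη⟩ := exists_ne (0 : H)
    have mem_closure := hS η
    rw [Submodule.span_empty, Submodule.bot_coe, closure_singleton] at mem_closure
    exact hη mem_closure

end Degenerate

section Dimension

variable {H : Type u} [NormedAddCommGroup H] [InnerProductSpace ℂ H] [CompleteSpace H]
  {X : Type v} [NormedAddCommGroup X] [NormedSpace ℂ X]
  [SMul (CompactOp H)ᵐᵒᵖ X] [CStarModule (CompactOp H)ᵐᵒᵖ X]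

theorem natCast_le_orthDim_of_mul_hilbertDim_le [Nontrivial H] {n : ℕ}
    (h : (n : Cardinal.{max u v}) * Cardinal.lift.{v, u} (hilbertDim H) ≤
      Cardinal.lift.{u, v} (orthDim (CompactOp H) X)) :
    (n : Cardinal) ≤ orthDim (CompactOp H) X := by
  have one_le : (1 : Cardinal.{max u v}) ≤ Cardinal.lift.{v, u} (hilbertDim H) := by
    rw [← Cardinal.lift_one.{u, v}, Cardinal.lift_le]
    exact one_le_hilbertDim
  rw [← Cardinal.lift_le.{u, v}, Cardinal.lift_natCast]
  exact (le_mul_of_one_le_right' one_le).trans h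

end Dimension

end HilbertMulti

end

theorem mainTheorem3_general {H : Type*} [NormedAddCommGroup H] [InnerProductSpace ℂ H]
    [CompleteSpace H] {X : Type*} [NormedAddCommGroup X] [NormedSpace ℂ X] [CompleteSpace X]
    [SMul (HilbertMulti.CompactOp H)ᵐᵒᵖ X] [CStarModule (HilbertMulti.CompactOp H)ᵐᵒᵖ X]
    {n : ℕ} (x : Fin n → X) :
    HilbertMulti.hilbertMultiNorm (HilbertMulti.CompactOp H)ᵐᵒᵖ x =
        HilbertMulti.pureStateMultiNorm (HilbertMulti.CompactOp H) x ∧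
      ((Nontrivial H → (n : Cardinal) ≤ HilbertMulti.orthDim (HilbertMulti.CompactOp H) X) →
        HilbertMulti.hilbertMultiNorm (HilbertMulti.CompactOp H)ᵐᵒᵖ x =
          HilbertMulti.starMultiNorm (HilbertMulti.CompactOp H) x) := by
  refine ⟨HilbertMulti.hilbertMultiNorm_eq_pureStateMultiNorm x, fun hn => ?_⟩
  rcases subsingleton_or_nontrivial H with _ | hH
  · exact HilbertMulti.hilbertMultiNorm_eq_starMultiNorm_of_subsingleton x
  · exact HilbertMulti.hilbertMultiNorm_eq_starMultiNorm (hn hH) x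

theorem mainTheorem3 {H : Type u} [NormedAddCommGroup H] [InnerProductSpace ℂ H]
    [CompleteSpace H] {X : Type v} [NormedAddCommGroup X] [NormedSpace ℂ X] [CompleteSpace X]
    [SMul (HilbertMulti.CompactOp H)ᵐᵒᵖ X] [CStarModule (HilbertMulti.CompactOp H)ᵐᵒᵖ X]
    {n : ℕ} (x : Fin n → X) :
    HilbertMulti.hilbertMultiNorm (HilbertMulti.CompactOp H)ᵐᵒᵖ x =
        HilbertMulti.pureStateMultiNorm (HilbertMulti.CompactOp H) x ∧
      (TopologicalSpace.SeparableSpace H →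
        (n : Cardinal.{max u v}) * Cardinal.lift.{v, u} (HilbertMulti.hilbertDim H) ≤
          Cardinal.lift.{u, v} (HilbertMulti.orthDim (HilbertMulti.CompactOp H) X) →
        HilbertMulti.hilbertMultiNorm (HilbertMulti.CompactOp H)ᵐᵒᵖ x =
          HilbertMulti.starMultiNorm (HilbertMulti.CompactOp H) x) :=
  ⟨(mainTheorem3_general x).1, fun _ hdim => (mainTheorem3_general x).2 fun _ =>
    HilbertMulti.natCast_le_orthDim_of_mul_hilbertDim_le hdim⟩
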